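/- Let $n\ge 1$, $0<s<1$, $p>2$. For an open set $U\subset\mathbb R^n$ put $$\|g\|_{W^{s,p}(U)}^p=\int_U|g|^p\,dx+\iint_{U\times U}\frac{|g(x)-g(y)|^p}{|x-y|^{n+sp}}\,dx\,dy ,$$ and let $W_0^{s,p}(\Omega)$ be the closure of $C_0^\infty(\Omega)$ in the norm of $W^{s,p}(\mathbb R^n)$. Let $L^{p-1}_{sp}(\mathbb R^n)$ be the space of measurable $g$ with $\int_{\mathbb R^n}|g|^{p-1}(1+|x|^{n+sp})^{-1}dx<\infty$. For bounded open sets $\Omega\Subset\Omega'$ let $X_0^{s,p}(\Omega,\Omega')$ be the space of $g\in W^{s,p}(\Omega')\cap L^{p-1}_{sp}(\mathbb R^n)$ with $g=0$ a.e. on $\mathbb R^n\setminus\Omega$, with the norm of $W^{s,p}(\Omega')$, and let $f\in L^{p'}_{\rm loc}((0,\infty);(X_0^{s,p}(\Omega,\Omega'))^*)$, $p'=p/(p-1)$. With $J_p(\tau)=|\tau|^{p-2}\tau$, a measurable function $u$ on $\mathbb R^n\times(0,\infty)$ is a weak solution of $u_t+(-\Delta_p)^su=f$ in $\Omega\times(0,\infty)$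 if for every $J=[T_0,T_1]\subset(0,\infty)$ one has $$u\in L^p(J;W^{s,p}(\Omega'))\cap L^{p-1}(J;L^{p-1}_{sp}(\mathbb R^n))\cap C(J;L^2(\Omega))$$ and, for every $\phi\in L^p(J;X_0^{s,p}(\Omega,\Omega'))\cap C^1(J;L^2(\Omega))$, $$-\int_J\!\int_\Omega u\,\partial_t\phi\,dx\,dt+\int_J\!\iint_{\mathbb R^n\times\mathbb R^n}\frac{J_p(u(x,t)-u(y,t))(\phi(x,t)-\phi(y,t))}{|x-y|^{n+sp}}\,dx\,dy\,dt=\int_\Omega u(x,T_0)\phi(x,T_0)\,dx-\int_\Omega u(x,T_1)\phi(x,T_1)\,dx+\int_J\langle f(\cdot,t),\phi(\cdot,t)\rangle\,dt .$$ **Proposition.** Let $u$ and $v$ be weak solutions of $u_t+(-\Delta_p)^su=f$ in $\Omega\times(0,\infty)$ (with the same $\Omega,\Omega',f$ as above) such that $w=u-v\in L^p_{\rm loc}((0,\infty);W_0^{s,p}(\Omega))$, and let $0<T\le t_2$. (i) If $sp<n$, then $$\|w\|_{L^\infty([T,t_2]\times\Omega)}^{\frac{n(p-2)}{sp}+p}\le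 C_1\,T^{-\frac{n+sp}{sp}}\int_{T/2}^{t_2}\int_\Omega|w|^p\,dx\,dt ,$$ where $C_1>0$ depends only on $n,p,s$. (ii) If $n\le sp<N$, with $N$ a real number, then $$\|w\|_{L^\infty([T,t_2]\times\Omega)}^{\frac{N(p-2)}{sp}+p}\le C_2\,T^{-\frac{N+sp}{sp}}\int_{T/2}^{t_2}\int_\Omega|w|^p\,dx\,dt ,$$ where $C_2>0$ depends only on $n,p,s,N$ and $\Omega$. -/

import Mathlib

open MeasureTheory Set Filter Topology
open scoped ENNReal ContDiff

noncomputable section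

namespace FracPLap

/-- The Euclidean space `ℝⁿ`. -/
abbrev E (n : ℕ) : Type := EuclideanSpace ℝ (Fin n)

/-- `J_p(t) = |t|^{p-2} t`. -/
def Jp (p t : ℝ) : ℝ := |t| ^ (p - 2) * t

variable {n : ℕ}

/-- The quotient `(u(x) - u(y)) / |x - y|^{n/p + s}`. The `p`-th power of its absolute value is
`|u(x) - u(y)|^p / |x - y|^{n + sp}`. -/
def quot (s p : ℝ) (u : E n → ℝ) (z : E n × E n) : ℝ :=
  (u z.1 - u z.2) / ‖z.1 - z.2‖ ^ ((n : ℝ) / p + s)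

/-- Lebesgue measure on `U × U`. -/
def sqMeasure (U : Set (E n)) : Measure (E n × E n) :=
  (volume.restrict U).prod (volume.restrict U)

/-- `u ∈ W^{s,p}(U)`: `u ∈ L^p(U)` and the Sobolev-Slobodeckii seminorm of `u` on `U` is finite. -/
def MemW (s p : ℝ) (U : Set (E n)) (u : E n → ℝ) : Prop :=
  MemLp u (ENNReal.ofReal p) (volume.restrict U) ∧
    MemLp (quot s p u) (ENNReal.ofReal p) (sqMeasure U)

/-- `‖u‖_{W^{s,p}(U)}^p = ‖u‖_{L^p(U)}^p + ∬_{U × U} |u(x) - u(y)|^p / |x - y|^{n + sp} dx dy`,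
with values in `[0, ∞]`. -/
def wNormPow (s p : ℝ) (U : Set (E n)) (u : E n → ℝ) : ℝ≥0∞ :=
  (∫⁻ x in U, ‖u x‖ₑ ^ p) +
    ∫⁻ z in U ×ˢ U, ENNReal.ofReal (|u z.1 - u z.2| ^ p / ‖z.1 - z.2‖ ^ ((n : ℝ) + s * p))

/-- `u ∈ W_0^{s,p}(Ω)`: `u` lies in the closure of `C_0^∞(Ω)` for the norm of `W^{s,p}(ℝⁿ)`. -/
def MemW0 (s p : ℝ) (Ω : Set (E n)) (u : E n → ℝ) : Prop :=
  MemW s p univ u ∧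
    ∀ ε : ℝ≥0∞, 0 < ε → ∃ g : E n → ℝ, ContDiff ℝ ∞ g ∧ HasCompactSupport g ∧
      tsupport g ⊆ Ω ∧ wNormPow s p univ (fun x => u x - g x) < ε

/-- The measure `dx / (1 + |x|^{n + α})` on `ℝⁿ`. -/
def tailMeasure (n : ℕ) (α : ℝ) : Measure (E n) :=
  volume.withDensity fun x => ENNReal.ofReal (1 / (1 + ‖x‖ ^ ((n : ℝ) + α)))

/-- `u ∈ L^q_α(ℝⁿ)`, the tail space: `∫ |u|^q / (1 + |x|^{n + α}) dx < ∞`. (Since the weight is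
bounded below by a positive constant on bounded sets, such `u` are in `L^q_loc`.) -/
def MemTail (q α : ℝ) (u : E n → ℝ) : Prop :=
  MemLp u (ENNReal.ofReal q) (tailMeasure n α)

theorem quot_add (s p : ℝ) (u v : E n → ℝ) : quot s p (u + v) = quot s p u + quot s p v := by
  ext z
  simp only [quot, Pi.add_apply]
  ring

theorem quot_smul (s p c : ℝ) (u : E n → ℝ) : quot s p (c • u) = c • quot s p u := by
  ext z
  simp only [quot, Pi.smul_apply, smul_eq_mul]
  ring

theorem quot_zero (s p : ℝ) : quot s p (0 : E n → ℝ) = 0 := by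
  ext z
  simp [quot]

/-- `X_0^{s,p}(Ω, Ω')`: the functions in `W^{s,p}(Ω') ∩ L^{p-1}_{sp}(ℝⁿ)` that vanish almost
everywhere on `ℝⁿ \ Ω`. -/
def xZero (s p : ℝ) (Ω Ω' : Set (E n)) : Submodule ℝ (E n → ℝ) where
  carrier := {v | MemW s p Ω' v ∧ MemTail (p - 1) (s * p) v ∧ ∀ᵐ x, x ∉ Ω → v x = 0}
  zero_mem' := by
    refine ⟨⟨MemLp.zero, ?_⟩, MemLp.zero, by simp⟩
    rw [quot_zero]
    exact MemLp.zero
  add_mem' := by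
    rintro u v ⟨hu, hu', hu''⟩ ⟨hv, hv', hv''⟩
    refine ⟨⟨hu.1.add hv.1, ?_⟩, hu'.add hv', ?_⟩
    · rw [quot_add]
      exact hu.2.add hv.2
    · filter_upwards [hu'', hv''] with x h1 h2 hx
      simp [h1 hx, h2 hx]
  smul_mem' := by
    rintro c u ⟨hu, hu', hu''⟩
    refine ⟨⟨hu.1.const_smul c, ?_⟩, hu'.const_smul c, ?_⟩
    · rw [quot_smul]
      exact hu.2.const_smul c
    · filter_upwards [hu''] with x h1 hx
      simp [h1 hx]

/-- The space `X_0^{s,p}(Ω, Ω')` as a type of its own (so that it does not inherit the topology of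
pointwise convergence); below it gets the norm of `W^{s,p}(Ω')`. -/
def XZero (s p : ℝ) (Ω Ω' : Set (E n)) : Type := xZero s p Ω Ω'

instance (s p : ℝ) (Ω Ω' : Set (E n)) : AddCommGroup (XZero s p Ω Ω') :=
  inferInstanceAs (AddCommGroup (xZero s p Ω Ω'))

instance (s p : ℝ) (Ω Ω' : Set (E n)) : Module ℝ (XZero s p Ω Ω') :=
  inferInstanceAs (Module ℝ (xZero s p Ω Ω'))

/-- An element of `X_0^{s,p}(Ω, Ω')` as a function. -/
def XZero.fn {s p : ℝ} {Ω Ω' : Set (E n)} (v : XZero s p Ω Ω') : E n → ℝ :=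
  Subtype.val (p := fun g => g ∈ xZero s p Ω Ω') v

/-- The element of `X_0^{s,p}(Ω, Ω')` given by a function with the required properties. -/
def XZero.mk {s p : ℝ} {Ω Ω' : Set (E n)} (g : E n → ℝ) (h : g ∈ xZero s p Ω Ω') :
    XZero s p Ω Ω' :=
  Subtype.mk (p := fun g => g ∈ xZero s p Ω Ω') g h

theorem XZero.memW {s p : ℝ} {Ω Ω' : Set (E n)} (v : XZero s p Ω Ω') : MemW s p Ω' v.fn :=
  (Subtype.property (p := fun g => g ∈ xZero s p Ω Ω') v).1

instance {p : ℝ} [hp : Fact (1 < p)] : Fact (1 ≤ ENNReal.ofReal p) :=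
  ⟨by simpa using ENNReal.ofReal_le_ofReal hp.out.le⟩

/-- The linear map `v ↦ (v, (v(x) - v(y)) / |x - y|^{n/p + s})` from `X_0^{s,p}(Ω, Ω')` to the
`ℓ^p`-product `L^p(Ω') × L^p(Ω' × Ω')`; it induces the norm of `W^{s,p}(Ω')`. -/
def XZero.embed (s p : ℝ) [Fact (1 < p)] (Ω Ω' : Set (E n)) :
    XZero s p Ω Ω' →ₗ[ℝ] WithLp (ENNReal.ofReal p)
      (Lp ℝ (ENNReal.ofReal p) (volume.restrict Ω') ×
        Lp ℝ (ENNReal.ofReal p) (sqMeasure Ω')) where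
  toFun v := WithLp.toLp _ (v.memW.1.toLp v.fn, v.memW.2.toLp (quot s p v.fn))
  map_add' u v := by
    rw [← WithLp.toLp_add, Prod.mk_add_mk, ← MemLp.toLp_add, ← MemLp.toLp_add]
    congr 3
    exact quot_add s p u.fn v.fn
  map_smul' c u := by
    rw [RingHom.id_apply, ← WithLp.toLp_smul, Prod.smul_mk, ← MemLp.toLp_const_smul,
      ← MemLp.toLp_const_smul]
    congr 3
    exact quot_smul s p c u.fn

instance (s p : ℝ) [Fact (1 < p)] (Ω Ω' : Set (E n)) : SeminormedAddCommGroup (XZero s p Ω Ω') :=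
  SeminormedAddCommGroup.induced _ _ (XZero.embed s p Ω Ω')

instance (s p : ℝ) [Fact (1 < p)] (Ω Ω' : Set (E n)) : NormedSpace ℝ (XZero s p Ω Ω') :=
  NormedSpace.induced ℝ _ _ (XZero.embed s p Ω Ω')

/-- The dual space `(X_0^{s,p}(Ω, Ω'))^*` with the operator norm. -/
abbrev XZeroDual (s p : ℝ) [Fact (1 < p)] (Ω Ω' : Set (E n)) : Type :=
  StrongDual ℝ (XZero s p Ω Ω')

/-- `f ∈ L^{p'}_loc((0,∞); (X_0^{s,p}(Ω, Ω'))^*)` with `p' = p / (p - 1)`. -/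
def MemDualLoc (s p : ℝ) [Fact (1 < p)] (Ω Ω' : Set (E n)) (f : ℝ → XZeroDual s p Ω Ω') : Prop :=
  ∀ a b : ℝ, 0 < a → a < b →
    MemLp f (ENNReal.ofReal (p / (p - 1))) (volume.restrict (Icc a b))

/-- Joint Lebesgue measurability of `u(x,t)` on `ℝⁿ × J`. -/
def JointMeas (J : Set ℝ) (u : ℝ → E n → ℝ) : Prop :=
  AEStronglyMeasurable (fun q : ℝ × E n => u q.1 q.2) ((volume.restrict J).prod volume)

/-- `u ∈ L^p(J; W^{s,p}(U))`. -/
def MemLpW (s p : ℝ) (U : Set (E n)) (J : Set ℝ) (u : ℝ → E n → ℝ) : Prop :=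
  JointMeas J u ∧ (∀ᵐ t ∂(volume.restrict J), MemW s p U (u t)) ∧
    ∫⁻ t in J, wNormPow s p U (u t) < ⊤

/-- `u ∈ L^{p-1}(J; L^{p-1}_{sp}(ℝⁿ))`. -/
def MemLpTail (s p : ℝ) (J : Set ℝ) (u : ℝ → E n → ℝ) : Prop :=
  JointMeas J u ∧ (∀ᵐ t ∂(volume.restrict J), MemTail (p - 1) (s * p) (u t)) ∧
    ∫⁻ t in J, ∫⁻ x, ‖u t x‖ₑ ^ (p - 1) ∂(tailMeasure n (s * p)) < ⊤

/-- `L²(Ω)`. -/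
abbrev L2 (Ω : Set (E n)) : Type := Lp ℝ 2 (volume.restrict Ω : Measure (E n))

/-- The curve `U` in `L²(Ω)` is `t ↦ u(·,t)|_Ω`, for every `t ∈ J`. -/
def IsL2Curve (Ω : Set (E n)) (J : Set ℝ) (u : ℝ → E n → ℝ) (U : ℝ → L2 Ω) : Prop :=
  ∀ t ∈ J, u t =ᵐ[volume.restrict Ω] U t

/-- `φ ∈ L^p(J; X_0^{s,p}(Ω, Ω')) ∩ C^1(J; L²(Ω))`, where `Φ` is `φ` seen as a curve in `L²(Ω)`. -/
structure IsTest (s p : ℝ) (Ω Ω' : Set (E n)) (J : Set ℝ) (φ : ℝ → E n → ℝ) (Φ : ℝ → L2 Ω) :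
    Prop where
  memLpW : MemLpW s p Ω' J φ
  mem_xZero : ∀ᵐ t ∂(volume.restrict J), φ t ∈ xZero s p Ω Ω'
  isL2Curve : IsL2Curve Ω J φ Φ
  contDiffOn : ContDiffOn ℝ 1 Φ J

open Classical in
/-- `⟨ℓ, g⟩` for `ℓ ∈ (X_0^{s,p}(Ω, Ω'))^*` and `g ∈ X_0^{s,p}(Ω, Ω')`. -/
def pairing {s p : ℝ} [Fact (1 < p)] {Ω Ω' : Set (E n)} (l : XZeroDual s p Ω Ω') (g : E n → ℝ) :
    ℝ :=
  if h : g ∈ xZero s p Ω Ω' then l (XZero.mk g h) else 0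

/-- `u` is a weak solution of `u_t + (-Δ_p)^s u = f` in `Ω × (0,∞)`. -/
structure IsWeakSolution (s p : ℝ) [Fact (1 < p)] (Ω Ω' : Set (E n))
    (f : ℝ → XZeroDual s p Ω Ω') (u : ℝ → E n → ℝ) : Prop where
  memLpW : ∀ a b : ℝ, 0 < a → a < b → MemLpW s p Ω' (Icc a b) u
  memLpTail : ∀ a b : ℝ, 0 < a → a < b → MemLpTail s p (Icc a b) u
  continuous_L2 : ∀ a b : ℝ, 0 < a → a < b →
    ∃ U : ℝ → L2 Ω, IsL2Curve Ω (Icc a b) u U ∧ ContinuousOn U (Icc a b)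
  equation : ∀ a b : ℝ, 0 < a → a < b → ∀ (φ : ℝ → E n → ℝ) (Φ : ℝ → L2 Ω),
    IsTest s p Ω Ω' (Icc a b) φ Φ →
      -(∫ t in Icc a b, ∫ x in Ω, u t x * (derivWithin Φ (Icc a b) t) x)
        + (∫ t in Icc a b, ∫ z : E n × E n,
            Jp p (u t z.1 - u t z.2) * (φ t z.1 - φ t z.2) / ‖z.1 - z.2‖ ^ ((n : ℝ) + s * p))
      = (∫ x in Ω, u a x * φ a x) - (∫ x in Ω, u b x * φ b x)
        + ∫ t in Icc a b, pairing (f t) (φ t)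

/-- `w ∈ L^p_loc((0,∞); W_0^{s,p}(Ω))`. -/
def MemLpLocW0 (s p : ℝ) (Ω : Set (E n)) (w : ℝ → E n → ℝ) : Prop :=
  ∀ a b : ℝ, 0 < a → a < b →
    MemLpW s p univ (Icc a b) w ∧ ∀ᵐ t ∂(volume.restrict (Icc a b)), MemW0 s p Ω (w t)

/-- The assumptions on the data: `Ω` and `Ω'` are bounded open sets with `Ω ⋐ Ω'`,
`f ∈ L^{p'}_loc((0,∞); (X_0^{s,p}(Ω, Ω'))^*)`, the functions `u` and `v` are weak solutions of
`u_t + (-Δ_p)^s u = f` in `Ω × (0,∞)`, and `u - v ∈ L^p_loc((0,∞); W_0^{s,p}(Ω))`. -/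
structure SolutionPair (s p : ℝ) [Fact (1 < p)] (Ω Ω' : Set (E n))
    (f : ℝ → XZeroDual s p Ω Ω') (u v : ℝ → E n → ℝ) : Prop where
  isOpen : IsOpen Ω
  isBounded : Bornology.IsBounded Ω
  isOpen' : IsOpen Ω'
  isBounded' : Bornology.IsBounded Ω'
  closure_subset : closure Ω ⊆ Ω'
  memDualLoc : MemDualLoc s p Ω Ω' f
  solution_u : IsWeakSolution s p Ω Ω' f u
  solution_v : IsWeakSolution s p Ω Ω' f v
  memW0 : MemLpLocW0 s p Ω (fun t x => u t x - v t x)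

/-- The estimate
`‖w‖_{L^∞([T,t₂] × Ω)}^{d(p-2)/(sp) + p} ≤ C T^{-(d+sp)/(sp)} ∫_{T/2}^{t₂} ∫_Ω |w|^p dx dt`,
between elements of `[0, ∞]`. -/
def MoserBound (s p d C : ℝ) (Ω : Set (E n)) (w : ℝ → E n → ℝ) (T t₂ : ℝ) : Prop :=
  eLpNorm (fun q : ℝ × E n => w q.1 q.2) ⊤ (volume.restrict (Icc T t₂ ×ˢ Ω))
      ^ (d * (p - 2) / (s * p) + p)
    ≤ ENNReal.ofReal (C * T ^ (-((d + s * p) / (s * p)))) *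
        ∫⁻ t in Icc (T / 2) t₂, ∫⁻ x in Ω, ‖w t x‖ₑ ^ p

end FracPLap

end

/-!
The sup bound is a De Giorgi iteration for `w = u - v`, in which a Faber-Krahn inequality takes the
place of the Sobolev embedding.

*Faber-Krahn.* If `g` is supported on a set of measure `m`, a ball of measure `2m` centred at `x`
meets the zero set of `g` in measure at least `m`, and there `g x - g y = g x`. Integrating over
these `y` and then over `x` bounds `‖g‖_p^p` by `C m^{sp/n}` times the Gagliardo seminorm
(`exists_faberKrahn`); the exponents `sp < n` and `sp ≥ n` need no distinction. On a bounded `Ω`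
the exponent `sp/n` may be lowered to `sp/N`, at the price of a factor depending on `|Ω|`.

*Energy inequality.* Formally one tests the equation for `w` with the truncation
`φ = min((w - k)₊, M)`, which is not regular enough in time. Instead, for almost every `t`, the
slice `φ(t + h)` is used as a test function that is constant in time on `[t, t + h]`
(`IsWeakSolution.flux_sub_eq`). Convexity of the primitive of the truncation bounds the increment
of its integral over `Ω` by the flux term. Replacing `φ(t + h)` by `φ(τ)` in that term costs the
pairing of the fluxes of `u` and `v` with a time difference of `φ`; it tends to zero after
integration in `t`, by continuity of translations in `L^p` near the diagonal and by dominated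
convergence in the tail, where `φ` is bounded (`SolClass.tendsto_flux_translate`). Averaging in `t`
then gives the exact inequality (`energy_le_of_increments`, `SolutionPair.energy`), and strong
monotonicity of `J_p` turns the flux into the seminorm of the truncation.

*Iteration.* Averaging the energy inequality over the initial time gives a Caccioppoli inequality
(`SolutionPair.caccioppoli`), in which the quadratic energy is estimated by the `p`-th power of the
excess over a lower level. Chebyshev and Faber-Krahn close the recursion
`Y_{j+1} ≤ A b^j Y_j^{1+ν}` for `Y_j = ∫∫ (w - k_j)₊^p` (`SolutionPair.excess_step`), with
`ν = sp/n` or `sp/N`. So `Y_j → 0`, that is `w ≤ k`, as soon as `k` raised to the exponent of the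
claim exceeds the right-hand side (`SolutionPair.ae_le_of_level`). Exchanging `u` and `v` gives the
bound from below.
-/

noncomputable section

namespace FracPLap

variable {n : ℕ}

/-! ### Monotonicity of `J_p` and quotients -/

theorem Jp_neg (p t : ℝ) : Jp p (-t) = -Jp p t := by
  simp [Jp]

theorem Jp_of_nonneg {p t : ℝ} (hp : 1 < p) (ht : 0 ≤ t) : Jp p t = t ^ (p - 1) := by
  rw [Jp, abs_of_nonneg ht]
  rcases ht.eq_or_lt with rfl | h
  · rw [mul_zero, Real.zero_rpow (by linarith)]
  · rw [← Real.rpow_add_one h.ne']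
    ring_nf

theorem abs_Jp {p : ℝ} (hp : 1 < p) (t : ℝ) : |Jp p t| = |t| ^ (p - 1) := by
  rcases le_total 0 t with h | h
  · rw [Jp_of_nonneg hp h, abs_of_nonneg h, abs_of_nonneg (by positivity)]
  · have := Jp_of_nonneg hp (neg_nonneg.2 h)
    rw [Jp_neg] at this
    rw [← abs_neg, this, abs_of_nonpos h, abs_of_nonneg]
    exact Real.rpow_nonneg (by linarith) _

/-- Strong monotonicity of `J_p` for `p ≥ 2`. -/
theorem rpow_le_Jp_sub {p a b : ℝ} (hp : 2 ≤ p) (hab : b ≤ a) :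
    2 ^ (2 - p) * (a - b) ^ (p - 1) ≤ Jp p a - Jp p b := by
  have hp1 : 1 < p := by linarith
  have hq : 1 ≤ p - 1 := by linarith
  have h2 : (2 : ℝ) ^ (2 - p) ≤ 1 :=
    Real.rpow_le_one_of_one_le_of_nonpos one_le_two (by linarith)
  -- the case where both numbers have the same sign
  have key : ∀ {a b : ℝ}, 0 ≤ b → b ≤ a →
      2 ^ (2 - p) * (a - b) ^ (p - 1) ≤ Jp p a - Jp p b := by
    intro a b hb hab
    rw [Jp_of_nonneg hp1 hb, Jp_of_nonneg hp1 (hb.trans hab)]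
    have h := Real.add_rpow_le_rpow_add (sub_nonneg.2 hab) hb hq
    rw [sub_add_cancel] at h
    have h3 : 0 ≤ (a - b) ^ (p - 1) := Real.rpow_nonneg (sub_nonneg.2 hab) _
    nlinarith
  rcases le_total 0 b with hb | hb
  · exact key hb hab
  rcases le_total a 0 with ha | ha
  · have := key (neg_nonneg.2 ha) (neg_le_neg hab)
    rw [Jp_neg, Jp_neg] at this
    convert this using 1 <;> ring_nf
  · have h1 := Jp_of_nonneg hp1 (neg_nonneg.2 hb)
    rw [Jp_neg] at h1
    have h : (a + -b) ^ (p - 1) ≤ 2 ^ (p - 1 - 1) * (a ^ (p - 1) + (-b) ^ (p - 1)) := by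
      have h := NNReal.rpow_add_le_mul_rpow_add_rpow a.toNNReal (-b).toNNReal hq
      rw [← NNReal.coe_le_coe] at h
      push_cast [Real.coe_toNNReal _ ha, Real.coe_toNNReal _ (neg_nonneg.2 hb)] at h
      exact h
    rw [Jp_of_nonneg hp1 ha, sub_eq_add_neg (a ^ (p - 1)), sub_eq_add_neg a b, h1]
    calc (2 : ℝ) ^ (2 - p) * (a + -b) ^ (p - 1)
        ≤ 2 ^ (2 - p) * (2 ^ (p - 1 - 1) * (a ^ (p - 1) + (-b) ^ (p - 1))) := by gcongr
      _ = a ^ (p - 1) + (-b) ^ (p - 1) := by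
          rw [← mul_assoc, ← Real.rpow_add two_pos, show 2 - p + (p - 1 - 1) = 0 by ring,
            Real.rpow_zero, one_mul]

/-- Coercivity of `J_p` against a contraction `d` of the increment `a - b`. -/
theorem coercive_Jp {p a b d : ℝ} (hp : 2 ≤ p) (hd : |d| ≤ |a - b|) (hs : 0 ≤ d * (a - b)) :
    2 ^ (2 - p) * |d| ^ p ≤ (Jp p a - Jp p b) * d := by
  have key : ∀ {a b d : ℝ}, 0 ≤ d → d ≤ a - b →
      2 ^ (2 - p) * d ^ p ≤ (Jp p a - Jp p b) * d := by
    intro a b d hd h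
    have h1 := rpow_le_Jp_sub hp (sub_nonneg.1 (hd.trans h))
    have h2 : d ^ (p - 1) ≤ (a - b) ^ (p - 1) := Real.rpow_le_rpow hd h (by linarith)
    have h3 : d ^ p = d ^ (p - 1) * d := by
      rcases hd.eq_or_lt with rfl | hd
      · rw [mul_zero, Real.zero_rpow (by linarith)]
      · rw [← Real.rpow_add_one hd.ne']
        ring_nf
    rw [h3, ← mul_assoc]
    refine mul_le_mul_of_nonneg_right (le_trans ?_ h1) hd
    gcongr
  rcases lt_trichotomy d 0 with h | rfl | h
  · have hab : a - b ≤ 0 := by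
      by_contra! h'
      nlinarith
    rw [abs_of_neg h, abs_of_nonpos hab] at hd
    have := key (a := b) (b := a) (neg_nonneg.2 h.le) (by linarith)
    rw [abs_of_neg h]
    linarith
  · simp [Real.zero_rpow (show p ≠ 0 by linarith)]
  · have hab : 0 ≤ a - b := by
      by_contra! h'
      nlinarith
    rw [abs_of_pos h, abs_of_nonneg hab] at hd
    rw [abs_of_pos h]
    exact key h.le hd

theorem measurable_Jp (p : ℝ) : Measurable (Jp p) := by
  unfold Jp
  fun_prop

theorem Jp_mul_of_nonneg {p c : ℝ} (hp : 1 < p) (hc : 0 ≤ c) (t : ℝ) :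
    Jp p (c * t) = c ^ (p - 1) * Jp p t := by
  rw [← Jp_of_nonneg hp hc, Jp, Jp, Jp, abs_mul, abs_of_nonneg hc,
    Real.mul_rpow hc (abs_nonneg t)]
  ring

/-- In terms of the quotients `quot`, the integrand of the weak formulation is
`J_p(quot u) * quot φ`. -/
theorem Jp_quot_mul_quot {s p : ℝ} (hp : 1 < p) (u φ : E n → ℝ) (z : E n × E n) :
    Jp p (quot s p u z) * quot s p φ z =
      Jp p (u z.1 - u z.2) * (φ z.1 - φ z.2) / ‖z.1 - z.2‖ ^ ((n : ℝ) + s * p) := by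
  set r := ‖z.1 - z.2‖ ^ ((n : ℝ) / p + s) with hr
  have hr0 : 0 ≤ r := by positivity
  have hrp : ‖z.1 - z.2‖ ^ ((n : ℝ) + s * p) = r ^ p := by
    rw [hr, ← Real.rpow_mul (norm_nonneg _), add_mul, div_mul_cancel₀ _ (by linarith)]
  have h1 : r ^ p = r ^ (p - 1) * r := by
    rcases hr0.eq_or_lt with h | h
    · rw [← h, mul_zero, Real.zero_rpow (by linarith)]
    · rw [← Real.rpow_add_one h.ne']
      ring_nf
  rw [quot, quot, ← hr, hrp, h1, div_eq_inv_mul, Jp_mul_of_nonneg hp (by positivity),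
    Real.inv_rpow hr0]
  simp only [div_eq_mul_inv, mul_inv]
  ring

/-- The `p`-th power of the quotient, as it appears in `wNormPow`. -/
theorem enorm_quot_rpow {s p : ℝ} (hp : 0 < p) (u : E n → ℝ) (z : E n × E n) :
    ‖quot s p u z‖ₑ ^ p =
      ENNReal.ofReal (|u z.1 - u z.2| ^ p / ‖z.1 - z.2‖ ^ ((n : ℝ) + s * p)) := by
  rw [← ofReal_norm, ENNReal.ofReal_rpow_of_nonneg (norm_nonneg _) hp.le, quot, norm_div,
    Real.norm_of_nonneg (Real.rpow_nonneg (norm_nonneg (z.1 - z.2)) _),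
    Real.div_rpow (norm_nonneg _) (by positivity), ← Real.rpow_mul (norm_nonneg (z.1 - z.2)),
    add_mul, div_mul_cancel₀ _ hp.ne', Real.norm_eq_abs]

theorem quot_swap (s p : ℝ) (u : E n → ℝ) (z : E n × E n) :
    quot s p u z.swap = -quot s p u z := by
  simp only [quot, Prod.fst_swap, Prod.snd_swap, norm_sub_rev z.2 z.1]
  ring

/-- Joint measurability of the quotients of a measurable family of functions. -/
theorem measurable_quot (s p : ℝ) {u : ℝ → E n → ℝ} (hu : Measurable (Function.uncurry u)) :
    Measurable fun q : ℝ × (E n × E n) => quot s p (u q.1) q.2 := by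
  have h1 : Measurable fun q : ℝ × (E n × E n) => u q.1 q.2.1 :=
    hu.comp (measurable_fst.prodMk (measurable_fst.comp measurable_snd))
  have h2 : Measurable fun q : ℝ × (E n × E n) => u q.1 q.2.2 :=
    hu.comp (measurable_fst.prodMk (measurable_snd.comp measurable_snd))
  unfold quot
  fun_prop

/-! ### The Faber-Krahn inequality and translations -/

theorem aemeasurable_quot (s p : ℝ) {g : E n → ℝ} (hg : AEMeasurable g) :
    AEMeasurable (quot s p g) (volume : Measure (E n × E n)) := by
  have h1 : AEMeasurable (fun z : E n × E n => g z.1) volume :=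
    hg.comp_quasiMeasurePreserving Measure.quasiMeasurePreserving_fst
  have h2 : AEMeasurable (fun z : E n × E n => g z.2) volume :=
    hg.comp_quasiMeasurePreserving Measure.quasiMeasurePreserving_snd
  unfold quot
  exact (h1.sub h2).div (by fun_prop)

/-- A fractional Faber-Krahn inequality: a function supported on a set of small measure is
controlled in `L^p` by its seminorm. A ball of twice the measure of the support, centred at `x`,
meets the zero set of `g` in a large set, and there `g(x) - g(y) = g(x)`. -/
theorem exists_faberKrahn (hn : 1 ≤ n) {s p : ℝ} (hs : 0 < s) (hp : 1 < p) :
    ∃ C : ℝ, 0 < C ∧ ∀ g : E n → ℝ, AEMeasurable g → volume {x | g x ≠ 0} ≠ ⊤ →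
      ∫⁻ x, ‖g x‖ₑ ^ p ≤ ENNReal.ofReal C * volume {x | g x ≠ 0} ^ (s * p / n) *
        ∫⁻ z, ‖quot s p g z‖ₑ ^ p := by
  have hn0 : (0 : ℝ) < n := by exact_mod_cast hn
  have hp0 : 0 < p := by linarith
  have hnp : 0 < n + s * p := by positivity
  have : Nonempty (Fin n) := ⟨⟨0, hn⟩⟩
  set V : ℝ := (volume (Metric.ball (0 : E n) 1)).toReal with hV
  have hVtop : volume (Metric.ball (0 : E n) 1) ≠ ⊤ := measure_ball_lt_top.ne
  have hV0 : 0 < V := ENNReal.toReal_pos (Metric.measure_ball_pos _ _ one_pos).ne' hVtop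
  refine ⟨(2 / V) ^ (1 + s * p / n), by positivity, fun g hg hfin => ?_⟩
  set m : ℝ := (volume {x | g x ≠ 0}).toReal with hm
  have hmV : volume {x | g x ≠ 0} = ENNReal.ofReal m := (ENNReal.ofReal_toReal hfin).symm
  have hm_nonneg : 0 ≤ m := ENNReal.toReal_nonneg
  rcases hm_nonneg.eq_or_lt with h0 | hm0
  · have hz : volume {x | g x ≠ 0} = 0 := by rw [hmV, ← h0, ENNReal.ofReal_zero]
    have hz' : ∀ᵐ x, g x = 0 := by simpa [ae_iff] using hz
    have : ∫⁻ x, ‖g x‖ₑ ^ p = 0 := by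
      rw [← lintegral_zero (μ := (volume : Measure (E n)))]
      refine lintegral_congr_ae ?_
      filter_upwards [hz'] with x hx
      simp [hx, hp0]
    rw [this]
    exact zero_le
  set r : ℝ := (2 * m / V) ^ (1 / (n : ℝ)) with hr
  have hr0 : 0 < r := by positivity
  have hrn : r ^ n * V = 2 * m := by
    rw [hr, ← Real.rpow_natCast, ← Real.rpow_mul (by positivity), one_div,
      inv_mul_cancel₀ hn0.ne', Real.rpow_one]
    field_simp
  have hball : ∀ x : E n, volume (Metric.ball x r) = ENNReal.ofReal (2 * m) := by
    intro x
    rw [Measure.addHaar_ball _ _ hr0.le, ← ENNReal.ofReal_toReal hVtop, ← hV,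
      ← ENNReal.ofReal_mul (by positivity), finrank_euclideanSpace_fin, hrn]
  have hS : NullMeasurableSet {x | g x = 0} := by
    have := hg.nullMeasurable (measurableSet_singleton (0 : ℝ))
    exact this
  -- the zero set fills at least half of the ball
  have hcap : ∀ x : E n, ENNReal.ofReal m ≤ volume (Metric.ball x r ∩ {x | g x = 0}) := by
    intro x
    have h1 : volume (Metric.ball x r) ≤
        volume (Metric.ball x r ∩ {x | g x = 0}) + volume {x | g x ≠ 0} := by
      refine (measure_mono ?_).trans (measure_union_le _ _)
      intro y hy
      by_cases h : g y = 0
      · exact Or.inl ⟨hy, h⟩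
      · exact Or.inr h
    rw [hball, hmV, two_mul, ENNReal.ofReal_add hm0.le hm0.le] at h1
    exact (ENNReal.add_le_add_iff_right ENNReal.ofReal_ne_top).1 h1
  have hpt : ∀ x : E n, ‖g x‖ₑ ^ p ≤ ENNReal.ofReal (r ^ (n + s * p) / m) *
      ∫⁻ y, ‖quot s p g (x, y)‖ₑ ^ p := by
    intro x
    have hlow : ENNReal.ofReal (|g x| ^ p / r ^ (n + s * p)) * ENNReal.ofReal m ≤
        ∫⁻ y, ‖quot s p g (x, y)‖ₑ ^ p := by
      calc ENNReal.ofReal (|g x| ^ p / r ^ (n + s * p)) * ENNReal.ofReal m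
          ≤ ENNReal.ofReal (|g x| ^ p / r ^ (n + s * p)) *
              volume (Metric.ball x r ∩ {x | g x = 0}) := by gcongr; exact hcap x
        _ = ∫⁻ _ in Metric.ball x r ∩ {x | g x = 0},
              ENNReal.ofReal (|g x| ^ p / r ^ (n + s * p)) := by rw [setLIntegral_const]
        _ ≤ ∫⁻ y in Metric.ball x r ∩ {x | g x = 0}, ‖quot s p g (x, y)‖ₑ ^ p := by
            refine lintegral_mono_ae ?_
            filter_upwards [ae_restrict_mem₀
              (measurableSet_ball.nullMeasurableSet.inter hS)] with y hy
            rw [enorm_quot_rpow hp0]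
            refine ENNReal.ofReal_le_ofReal ?_
            have hy0 : g y = 0 := hy.2
            have hyd : ‖x - y‖ ≤ r := by
              rw [← dist_eq_norm, dist_comm]
              exact (Metric.mem_ball.1 hy.1).le
            simp only [hy0, sub_zero]
            rcases eq_or_ne x y with rfl | hxy
            · simp [hy0, Real.zero_rpow hp0.ne']
            · have : 0 < ‖x - y‖ := norm_pos_iff.2 (sub_ne_zero.2 hxy)
              gcongr
        _ ≤ ∫⁻ y, ‖quot s p g (x, y)‖ₑ ^ p := setLIntegral_le_lintegral _ _
    have hgx : ‖g x‖ₑ ^ p = ENNReal.ofReal (r ^ (n + s * p) / m) *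
        (ENNReal.ofReal (|g x| ^ p / r ^ (n + s * p)) * ENNReal.ofReal m) := by
      rw [← ENNReal.ofReal_mul (by positivity), ← ENNReal.ofReal_mul (by positivity),
        ← ofReal_norm, ENNReal.ofReal_rpow_of_nonneg (norm_nonneg _) hp0.le, Real.norm_eq_abs]
      congr 1
      have : 0 < r ^ (n + s * p) := by positivity
      field_simp
    rw [hgx]
    gcongr
  have hconst : r ^ (n + s * p) / m = (2 / V) ^ (1 + s * p / n) * m ^ (s * p / n) := by
    have h1 : (1 / (n : ℝ)) * (n + s * p) = 1 + s * p / n := by field_simp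
    have h2 : 2 * m / V = 2 / V * m := by ring
    rw [hr, ← Real.rpow_mul (by positivity), h1, h2, Real.mul_rpow (by positivity) hm0.le,
      Real.rpow_add hm0, Real.rpow_one]
    field_simp
  calc ∫⁻ x, ‖g x‖ₑ ^ p
      ≤ ∫⁻ x, ENNReal.ofReal (r ^ (n + s * p) / m) * ∫⁻ y, ‖quot s p g (x, y)‖ₑ ^ p :=
        lintegral_mono hpt
    _ = ENNReal.ofReal (r ^ (n + s * p) / m) * ∫⁻ x, ∫⁻ y, ‖quot s p g (x, y)‖ₑ ^ p :=
        lintegral_const_mul' _ _ ENNReal.ofReal_ne_top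
    _ = _ := by
        rw [Measure.volume_eq_prod, lintegral_prod _
          ((aemeasurable_quot s p hg).enorm.pow_const p), hconst, hmV,
          ENNReal.ofReal_mul (by positivity), ENNReal.ofReal_rpow_of_pos hm0]

/-- Continuity of time translations in `L^p(ℝ × Z)`. -/
theorem tendsto_eLpNorm_translate_sub {p : ℝ≥0∞} [Fact (1 ≤ p)] (hp : p ≠ ⊤)
    {Q : ℝ × (E n × E n) → ℝ} (hQ : MemLp Q p volume) :
    Tendsto (fun δ : ℝ => eLpNorm (fun q => Q (q.1 + δ, q.2) - Q q) p volume) (𝓝 0) (𝓝 0) := by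
  have : Fact (p ≠ ⊤) := ⟨hp⟩
  have : (volume : Measure (E n × E n)).IsAddHaarMeasure :=
    Measure.prod.instIsAddHaarMeasure (volume : Measure (E n)) (volume : Measure (E n))
  have : (volume : Measure (ℝ × (E n × E n))).IsAddHaarMeasure :=
    Measure.prod.instIsAddHaarMeasure (volume : Measure ℝ) (volume : Measure (E n × E n))
  have : ContinuousVAdd (ℝ × E n × E n)ᵈᵃᵃ (Lp ℝ p (volume : Measure (ℝ × E n × E n))) :=
    Lp.instContinuousVAddDomAddAct
  let c : ℝ → ℝ × (E n × E n) := fun δ => (δ, 0)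
  have hc : Continuous c := by fun_prop
  have h1 : Tendsto (fun δ : ℝ => DomAddAct.mk (c δ) +ᵥ hQ.toLp Q) (𝓝 0)
      (𝓝 (DomAddAct.mk (c 0) +ᵥ hQ.toLp Q)) := by
    have : Continuous fun δ : ℝ => DomAddAct.mk (c δ) +ᵥ hQ.toLp Q := by
      have h2 : Continuous fun δ : ℝ => DomAddAct.mk (c δ) := DomAddAct.continuous_mk.comp hc
      exact h2.vadd continuous_const
    exact this.tendsto 0
  have h0 : DomAddAct.mk (c 0) +ᵥ hQ.toLp Q = hQ.toLp Q := by
    have : c 0 = 0 := rfl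
    rw [this, DomAddAct.mk_zero, zero_vadd]
  rw [h0, tendsto_iff_edist_tendsto_0] at h1
  refine h1.congr fun δ => ?_
  rw [DomAddAct.mk_vadd_toLp, Lp.edist_toLp_toLp]
  refine eLpNorm_congr_ae (Eventually.of_forall fun q => ?_)
  simp [c, add_comm, vadd_eq_add, Prod.add_def]

/-! ### Time translates of pairings -/

/-- The pairing of `Q(· + δ) - Q` with a fixed element of the dual exponent tends to zero. -/
theorem tendsto_lintegral_translate_of_Lq {p : ℝ} (hp : 1 < p) {Q : ℝ × (E n × E n) → ℝ}
    (hQ : MemLp Q (ENNReal.ofReal p) volume) {P : ℝ × (E n × E n) → ℝ≥0∞}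
    (hPm : Measurable P) (hP : ∫⁻ q, P q ^ (p / (p - 1)) ≠ ⊤) :
    Tendsto (fun δ : ℝ => ∫⁻ q, P q * ‖Q (q.1 + δ, q.2) - Q q‖ₑ) (𝓝 0) (𝓝 0) := by
  have : Fact (1 ≤ ENNReal.ofReal p) := ⟨by simpa using ENNReal.ofReal_le_ofReal hp.le⟩
  have hp0 : ENNReal.ofReal p ≠ 0 := by simp; linarith
  have h := tendsto_eLpNorm_translate_sub ENNReal.ofReal_ne_top hQ
  have hQs : ∀ δ : ℝ, AEStronglyMeasurable (fun q : ℝ × (E n × E n) => Q (q.1 + δ, q.2)) volume := by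
    intro δ
    have h1 : MeasurePreserving (fun q : ℝ × (E n × E n) => (q.1 + δ, q.2)) volume volume :=
      (measurePreserving_add_right volume δ).prod (MeasurePreserving.id volume)
    exact hQ.1.comp_measurePreserving h1
  have hc : Real.HolderConjugate (p / (p - 1)) p :=
    (Real.HolderConjugate.conjExponent hp).symm
  set K := (∫⁻ q, P q ^ (p / (p - 1))) ^ (1 / (p / (p - 1))) with hK
  have hKtop : K ≠ ⊤ := ENNReal.rpow_ne_top_of_nonneg (by have := hc.pos; positivity) hP
  refine tendsto_of_tendsto_of_tendsto_of_le_of_le tendsto_const_nhds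
    (h := fun δ => K * eLpNorm (fun q => Q (q.1 + δ, q.2) - Q q) (ENNReal.ofReal p) volume)
    ?_ (fun _ => zero_le) fun δ => ?_
  · simpa using ENNReal.Tendsto.const_mul h (Or.inr hKtop)
  · refine (ENNReal.lintegral_mul_le_Lp_mul_Lq volume hc hPm.aemeasurable
      ((hQs δ).sub hQ.1).enorm).trans_eq ?_
    beta_reduce
    rw [eLpNorm_eq_lintegral_rpow_enorm_toReal hp0 ENNReal.ofReal_ne_top,
      ENNReal.toReal_ofReal (by linarith)]
    rfl

/-- The pairing of `Q(· + δ) - Q` with an integrable weight tends to zero if `Q` is dominated by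
a time-independent function `S`. -/
theorem tendsto_lintegral_translate_of_bounded {p : ℝ} (hp : 1 < p)
    {Q : ℝ × (E n × E n) → ℝ} (hQm : Measurable Q)
    (hQ : MemLp Q (ENNReal.ofReal p) volume) {P : ℝ × (E n × E n) → ℝ≥0∞}
    (hPm : Measurable P) (hPtop : ∀ q, P q ≠ ⊤) {S : E n × E n → ℝ≥0∞}
    (hQS : ∀ q, ‖Q q‖ₑ ≤ S q.2) (hP : ∫⁻ q, P q * S q.2 ≠ ⊤) :
    Tendsto (fun δ : ℝ => ∫⁻ q, P q * ‖Q (q.1 + δ, q.2) - Q q‖ₑ) (𝓝 0) (𝓝 0) := by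
  have : Fact (1 ≤ ENNReal.ofReal p) := ⟨by simpa using ENNReal.ofReal_le_ofReal hp.le⟩
  have hp0 : ENNReal.ofReal p ≠ 0 := by simp; linarith
  have h := tendsto_eLpNorm_translate_sub ENNReal.ofReal_ne_top hQ
  have hQs : ∀ δ : ℝ, Measurable (fun q : ℝ × (E n × E n) => Q (q.1 + δ, q.2)) := fun δ =>
    hQm.comp (by fun_prop)
  refine tendsto_of_seq_tendsto fun δ hδ => tendsto_of_subseq_tendsto fun ns hns => ?_
  -- along a subsequence the translates converge almost everywhere
  have h1 : TendstoInMeasure volume (fun k q => Q (q.1 + δ (ns k), q.2) - Q q) atTop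
      (fun _ : ℝ × (E n × E n) => (0 : ℝ)) := by
    refine tendstoInMeasure_of_tendsto_eLpNorm hp0
      (fun k => ((hQs _).sub hQm).aestronglyMeasurable) aestronglyMeasurable_const ?_
    refine (h.comp (hδ.comp hns)).congr fun k => ?_
    refine eLpNorm_congr_ae (Eventually.of_forall fun q => ?_)
    simp
  obtain ⟨ms, -, hms⟩ := h1.exists_seq_tendsto_ae
  refine ⟨ms, ?_⟩
  have h2 := tendsto_lintegral_of_dominated_convergence (μ := volume)
    (F := fun k q => P q * ‖Q (q.1 + δ (ns (ms k)), q.2) - Q q‖ₑ) (f := fun _ => 0)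
    (fun q : ℝ × (E n × E n) => 2 * (P q * S q.2))
    (fun k => hPm.mul ((hQs _).sub hQm).enorm)
    (fun k => Eventually.of_forall fun q => ?_) ?_ ?_
  · simpa using h2
  · have h3 : ‖Q (q.1 + δ (ns (ms k)), q.2) - Q q‖ₑ ≤ 2 * S q.2 := by
      refine enorm_sub_le.trans ?_
      rw [two_mul]
      exact add_le_add (hQS (q.1 + δ (ns (ms k)), q.2)) (hQS q)
    calc P q * ‖Q (q.1 + δ (ns (ms k)), q.2) - Q q‖ₑ ≤ P q * (2 * S q.2) := by gcongr
      _ = 2 * (P q * S q.2) := by ring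
  · rw [lintegral_const_mul' _ _ (by simp)]
    exact ENNReal.mul_ne_top (by simp) hP
  · filter_upwards [hms] with q hq
    have h3 := (continuous_enorm.tendsto _).comp hq
    rw [enorm_zero] at h3
    simpa using ENNReal.Tendsto.const_mul h3 (Or.inr (hPtop q))

/-! ### Tail estimates -/

/-- The weight `|x - y|^{-(n/p + s)}` with which `quot` is formed. -/
def invWeight (s p : ℝ) (z : E n × E n) : ℝ≥0∞ :=
  ENNReal.ofReal (1 / ‖z.1 - z.2‖ ^ ((n : ℝ) / p + s))

theorem measurable_invWeight (s p : ℝ) : Measurable (invWeight s p : E n × E n → ℝ≥0∞) := by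
  unfold invWeight
  fun_prop

theorem enorm_quot (s p : ℝ) (u : E n → ℝ) (z : E n × E n) :
    ‖quot s p u z‖ₑ = ‖u z.1 - u z.2‖ₑ * invWeight s p z := by
  rw [quot, invWeight, div_eq_mul_one_div, enorm_mul,
    Real.enorm_of_nonneg (r := 1 / _) (by positivity)]

theorem enorm_Jp {p : ℝ} (hp : 1 < p) (t : ℝ) : ‖Jp p t‖ₑ = ‖t‖ₑ ^ (p - 1) := by
  rw [← ofReal_norm, ← ofReal_norm, ENNReal.ofReal_rpow_of_nonneg (norm_nonneg _) (by linarith),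
    Real.norm_eq_abs, Real.norm_eq_abs, abs_Jp hp]

theorem enorm_Jp_quot_mul_invWeight {s p : ℝ} (hp : 1 < p) (u : E n → ℝ) (z : E n × E n) :
    ‖Jp p (quot s p u z)‖ₑ * invWeight s p z =
      ‖u z.1 - u z.2‖ₑ ^ (p - 1) * ENNReal.ofReal (1 / ‖z.1 - z.2‖ ^ ((n : ℝ) + s * p)) := by
  have h : invWeight s p z ^ (p - 1) * invWeight s p z =
      ENNReal.ofReal (1 / ‖z.1 - z.2‖ ^ ((n : ℝ) + s * p)) := by
    have h1 : invWeight s p z ^ (p - 1) * invWeight s p z = invWeight s p z ^ p := by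
      have := ENNReal.rpow_add_of_nonneg (x := invWeight s p z) (p - 1) 1 (by linarith) zero_le_one
      rw [sub_add_cancel, ENNReal.rpow_one] at this
      exact this.symm
    rw [h1, invWeight, ENNReal.ofReal_rpow_of_nonneg (by positivity) (by linarith),
      Real.div_rpow zero_le_one (by positivity), Real.one_rpow, ← Real.rpow_mul (norm_nonneg _),
      add_mul, div_mul_cancel₀ _ (by linarith)]
  rw [enorm_Jp hp, enorm_quot, ENNReal.mul_rpow_of_nonneg _ _ (by linarith), mul_assoc, h]

/-- The weight `1 / (1 + |x|^r)` of the tail space. -/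
def tailWeight (r : ℝ) (x : E n) : ℝ≥0∞ := ENNReal.ofReal (1 / (1 + ‖x‖ ^ r))

theorem measurable_tailWeight (r : ℝ) : Measurable (tailWeight r : E n → ℝ≥0∞) := by
  unfold tailWeight
  fun_prop

theorem lintegral_tailMeasure (α : ℝ) {f : E n → ℝ≥0∞} (hf : Measurable f) :
    ∫⁻ x, f x ∂(tailMeasure n α) = ∫⁻ x, tailWeight (n + α) x * f x :=
  lintegral_withDensity_eq_lintegral_mul _ (measurable_tailWeight _) hf

theorem lintegral_tailWeight_ne_top {r : ℝ} (hr : (n : ℝ) < r) :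
    ∫⁻ x : E n, tailWeight r x ≠ ⊤ := by
  have hr0 : 0 < r := (Nat.cast_nonneg n).trans_lt hr
  have h := finite_integral_one_add_norm (E := E n) (μ := volume) (r := r)
    (by rwa [finrank_euclideanSpace_fin])
  have hle : ∀ x : E n, tailWeight r x ≤
      ENNReal.ofReal (2 ^ r) * ENNReal.ofReal ((1 + ‖x‖) ^ (-r)) := by
    intro x
    rw [tailWeight, ← ENNReal.ofReal_mul (by positivity)]
    refine ENNReal.ofReal_le_ofReal ?_
    have h1 : (1 + ‖x‖) ^ r ≤ 2 ^ r * (1 + ‖x‖ ^ r) := by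
      rcases le_total ‖x‖ 1 with hx | hx
      · calc (1 + ‖x‖) ^ r ≤ 2 ^ r := by
              apply Real.rpow_le_rpow (by positivity) (by linarith) hr0.le
          _ ≤ 2 ^ r * (1 + ‖x‖ ^ r) :=
              le_mul_of_one_le_right (by positivity) (by linarith [Real.rpow_nonneg (norm_nonneg x) r])
      · calc (1 + ‖x‖) ^ r ≤ (2 * ‖x‖) ^ r := by
              apply Real.rpow_le_rpow (by positivity) (by linarith) hr0.le
          _ = 2 ^ r * ‖x‖ ^ r := Real.mul_rpow zero_le_two (norm_nonneg _)
          _ ≤ 2 ^ r * (1 + ‖x‖ ^ r) := by gcongr; linarith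
    rw [Real.rpow_neg (by positivity), ← div_eq_mul_inv, div_le_div_iff₀ (by positivity)
      (by positivity), one_mul]
    exact h1
  refine ((lintegral_mono hle).trans_lt ?_).ne
  rw [lintegral_const_mul' _ _ ENNReal.ofReal_ne_top]
  exact ENNReal.mul_lt_top ENNReal.ofReal_lt_top h

/-- Off `Ω'` the kernel, seen from `Ω ⋐ Ω'`, is comparable with the tail weight. -/
theorem exists_kernel_le_tailWeight {Ω Ω' : Set (E n)} (hb : Bornology.IsBounded Ω)
    (ho' : IsOpen Ω') (hsub : closure Ω ⊆ Ω') {r : ℝ} (hr : 0 < r) :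
    ∃ C : ℝ, 0 < C ∧ ∀ x ∈ Ω, ∀ y ∉ Ω',
      ENNReal.ofReal (1 / ‖x - y‖ ^ r) ≤ ENNReal.ofReal C * tailWeight r y := by
  obtain ⟨R, hR⟩ := hb.exists_norm_le
  obtain ⟨δ, hδ, hδs⟩ := hb.isCompact_closure.exists_thickening_subset_open ho' hsub
  set R' := max R 0
  have hR0 : 0 ≤ R' := le_max_right _ _
  set c : ℝ := (1 + R' + δ) / δ with hc
  have hc0 : 0 < c := by positivity
  refine ⟨2 * c ^ r, by positivity, fun x hx y hy => ?_⟩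
  have hd : δ ≤ ‖x - y‖ := by
    by_contra! h
    refine hy (hδs (Metric.mem_thickening_iff.2 ⟨x, subset_closure hx, ?_⟩))
    rwa [dist_comm, dist_eq_norm]
  have hxR : ‖x‖ ≤ R' := (hR x hx).trans (le_max_left _ _)
  have hyd : ‖y‖ ≤ R' + ‖x - y‖ := by
    have := norm_sub_norm_le y x
    rw [norm_sub_rev] at this
    linarith
  have h0 : 0 < ‖x - y‖ := hδ.trans_le hd
  have h1 : 1 + ‖y‖ ≤ c * ‖x - y‖ := by
    rw [hc, div_mul_eq_mul_div, le_div_iff₀ hδ]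
    nlinarith
  have h2 : 1 + ‖y‖ ^ r ≤ 2 * c ^ r * ‖x - y‖ ^ r := by
    have h3 : (1 + ‖y‖) ^ r ≤ c ^ r * ‖x - y‖ ^ r := by
      rw [← Real.mul_rpow hc0.le h0.le]
      exact Real.rpow_le_rpow (by positivity) h1 hr.le
    have h4 : 1 ≤ (1 + ‖y‖) ^ r := Real.one_le_rpow (by linarith [norm_nonneg y]) hr.le
    have h5 : ‖y‖ ^ r ≤ (1 + ‖y‖) ^ r :=
      Real.rpow_le_rpow (norm_nonneg _) (by linarith) hr.le
    linarith
  rw [tailWeight, ← ENNReal.ofReal_mul (by positivity)]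
  refine ENNReal.ofReal_le_ofReal ?_
  rw [mul_one_div, div_le_div_iff₀ (by positivity) (by positivity), one_mul]
  exact h2

/-- The interaction of `Ω` with the complement of `Ω'` is controlled by the tail. -/
theorem exists_tail_bound {Ω Ω' : Set (E n)} (ho : IsOpen Ω) (hb : Bornology.IsBounded Ω)
    (ho' : IsOpen Ω') (hsub : closure Ω ⊆ Ω') {s p : ℝ} (hs : 0 < s) (hp : 2 < p) :
    ∃ C : ℝ≥0∞, C ≠ ⊤ ∧ ∀ u : E n → ℝ, Measurable u →
      ∫⁻ z in Ω ×ˢ Ω'ᶜ, ‖Jp p (quot s p u z)‖ₑ * invWeight s p z ≤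
        C * ∫⁻ x, ‖u x‖ₑ ^ (p - 1) ∂(tailMeasure n (s * p)) := by
  have hsp : 0 < s * p := by positivity
  set r : ℝ := n + s * p with hr
  have hr0 : 0 < r := by positivity
  obtain ⟨C, hC, hk⟩ := exists_kernel_le_tailWeight hb ho' hsub hr0
  obtain ⟨R, hR⟩ := hb.exists_norm_le
  set R' := max R 0
  have hR0 : 0 ≤ R' := le_max_right _ _
  set K : ℝ≥0∞ := ENNReal.ofReal (1 + R' ^ r)
  have hone : ∀ x ∈ Ω, 1 ≤ K * tailWeight r x := by
    intro x hx
    rw [tailWeight, ← ENNReal.ofReal_mul (by positivity), ← ENNReal.ofReal_one]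
    refine ENNReal.ofReal_le_ofReal ?_
    rw [mul_one_div, one_le_div (by positivity)]
    have := Real.rpow_le_rpow (norm_nonneg x) ((hR x hx).trans (le_max_left R 0)) hr0.le
    linarith
  set T : ℝ≥0∞ := ∫⁻ x : E n, tailWeight r x with hT
  have hTtop : T ≠ ⊤ := lintegral_tailWeight_ne_top (by linarith)
  set A : ℝ≥0∞ := 2 ^ (p - 1 - 1) * ENNReal.ofReal C with hA
  refine ⟨A * (K * T + volume Ω), ?_, fun u hu => ?_⟩
  · refine ENNReal.mul_ne_top (ENNReal.mul_ne_top
      (ENNReal.rpow_ne_top_of_nonneg (by linarith) (by simp)) ENNReal.ofReal_ne_top) ?_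
    exact ENNReal.add_ne_top.2 ⟨ENNReal.mul_ne_top ENNReal.ofReal_ne_top hTtop,
      hb.measure_lt_top.ne⟩
  have hum : Measurable fun x => ‖u x‖ₑ ^ (p - 1) := hu.enorm.pow_const _
  have hwm := measurable_tailWeight (n := n) r
  have hwu : Measurable fun x => tailWeight r x * ‖u x‖ₑ ^ (p - 1) := by fun_prop
  rw [lintegral_tailMeasure _ hum, ← hr]
  set X := ∫⁻ x, tailWeight r x * ‖u x‖ₑ ^ (p - 1) with hX
  have hmeas : MeasurableSet (Ω ×ˢ Ω'ᶜ) := ho.measurableSet.prod ho'.measurableSet.compl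
  calc ∫⁻ z in Ω ×ˢ Ω'ᶜ, ‖Jp p (quot s p u z)‖ₑ * invWeight s p z
      ≤ ∫⁻ z in Ω ×ˢ Ω'ᶜ, A * (K * ((tailWeight r z.1 * ‖u z.1‖ₑ ^ (p - 1)) * tailWeight r z.2) +
          tailWeight r z.2 * ‖u z.2‖ₑ ^ (p - 1)) := by
        refine setLIntegral_mono' hmeas fun z hz => ?_
        rw [enorm_Jp_quot_mul_invWeight (by linarith), ← hr]
        have h1 : ‖u z.1 - u z.2‖ₑ ^ (p - 1) ≤
            2 ^ (p - 1 - 1) * (‖u z.1‖ₑ ^ (p - 1) + ‖u z.2‖ₑ ^ (p - 1)) :=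
          (ENNReal.rpow_le_rpow enorm_sub_le (by linarith)).trans
            (ENNReal.rpow_add_le_mul_rpow_add_rpow _ _ (by linarith))
        calc _ ≤ 2 ^ (p - 1 - 1) * (‖u z.1‖ₑ ^ (p - 1) + ‖u z.2‖ₑ ^ (p - 1)) *
                (ENNReal.ofReal C * tailWeight r z.2) :=
              mul_le_mul' h1 (hk _ hz.1 _ hz.2)
          _ = A * (1 * (‖u z.1‖ₑ ^ (p - 1) * tailWeight r z.2) +
                tailWeight r z.2 * ‖u z.2‖ₑ ^ (p - 1)) := by rw [hA]; ring
          _ ≤ A * (K * tailWeight r z.1 * (‖u z.1‖ₑ ^ (p - 1) * tailWeight r z.2) +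
                tailWeight r z.2 * ‖u z.2‖ₑ ^ (p - 1)) := by
              gcongr
              exact hone _ hz.1
          _ = _ := by ring
    _ = A * (K * ∫⁻ z in Ω ×ˢ Ω'ᶜ, (tailWeight r z.1 * ‖u z.1‖ₑ ^ (p - 1)) * tailWeight r z.2) +
          A * ∫⁻ z in Ω ×ˢ Ω'ᶜ, 1 * (tailWeight r z.2 * ‖u z.2‖ₑ ^ (p - 1)) := by
        have h1 : Measurable fun z : E n × E n =>
            (tailWeight r z.1 * ‖u z.1‖ₑ ^ (p - 1)) * tailWeight r z.2 := by fun_prop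
        rw [lintegral_const_mul A (by fun_prop), lintegral_add_left (by fun_prop),
          lintegral_const_mul K h1, mul_add]
        simp only [one_mul]
    _ ≤ A * (K * (X * T)) + A * (volume Ω * X) := by
        have h1 : ∫⁻ z in Ω ×ˢ Ω'ᶜ, (tailWeight r z.1 * ‖u z.1‖ₑ ^ (p - 1)) * tailWeight r z.2 ≤
            X * T := by
          rw [Measure.volume_eq_prod, ← Measure.prod_restrict,
            lintegral_prod_mul hwu.aemeasurable hwm.aemeasurable]
          exact mul_le_mul' (setLIntegral_le_lintegral _ _) (setLIntegral_le_lintegral _ _)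
        have h2 : ∫⁻ z in Ω ×ˢ Ω'ᶜ, 1 * (tailWeight r z.2 * ‖u z.2‖ₑ ^ (p - 1)) ≤
            volume Ω * X := by
          rw [Measure.volume_eq_prod, ← Measure.prod_restrict,
            lintegral_prod_mul (f := fun _ => 1) aemeasurable_const hwu.aemeasurable,
            setLIntegral_one]
          exact mul_le_mul' le_rfl (setLIntegral_le_lintegral _ _)
        gcongr
    _ = A * (K * T + volume Ω) * X := by ring

/-- The mirrored form of `exists_tail_bound`. -/
theorem setLIntegral_swap_tail (Ω Ω' : Set (E n)) (s p : ℝ) (u : E n → ℝ) :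
    ∫⁻ z in Ω'ᶜ ×ˢ Ω, ‖Jp p (quot s p u z)‖ₑ * invWeight s p z =
      ∫⁻ z in Ω ×ˢ Ω'ᶜ, ‖Jp p (quot s p u z)‖ₑ * invWeight s p z := by
  have h : MeasurePreserving (Prod.swap : E n × E n → E n × E n) volume volume :=
    Measure.measurePreserving_swap
  have h2 := h.setLIntegral_comp_preimage_emb MeasurableEquiv.prodComm.measurableEmbedding
    (fun z => ‖Jp p (quot s p u z)‖ₑ * invWeight s p z) (Ω ×ˢ Ω'ᶜ)
  rw [← h2, Set.preimage_swap_prod]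
  refine lintegral_congr fun z => ?_
  rw [quot_swap, Jp_neg, enorm_neg, invWeight, invWeight, Prod.fst_swap, Prod.snd_swap,
    norm_sub_rev]

/-! ### Integrability and continuity of the flux -/

/-- A Borel function in `L^p(ℝ; W^{s,p}(Ω')) ∩ L^{p-1}(ℝ; L^{p-1}_{sp}(ℝⁿ))` (only the seminorm of
`W^{s,p}(Ω')` is recorded). Solutions on a compact time interval are extended by zero in time. -/
structure SolClass (s p : ℝ) (Ω' : Set (E n)) (u : ℝ → E n → ℝ) : Prop where
  meas : Measurable (Function.uncurry u)
  near : ∫⁻ t, ∫⁻ z in Ω' ×ˢ Ω', ‖quot s p (u t) z‖ₑ ^ p ≠ ⊤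
  tail : ∫⁻ t, ∫⁻ x, ‖u t x‖ₑ ^ (p - 1) ∂(tailMeasure n (s * p)) ≠ ⊤

/-- A bounded Borel function that vanishes off `Ω`, with finite seminorm in
`L^p(ℝ; W^{s,p}(ℝⁿ))`. -/
structure TestClass (s p M : ℝ) (Ω : Set (E n)) (φ : ℝ → E n → ℝ) : Prop where
  meas : Measurable (Function.uncurry φ)
  bound : ∀ t x, |φ t x| ≤ M
  supp : ∀ t, ∀ x ∉ Ω, φ t x = 0
  seminorm : ∫⁻ t, ∫⁻ z, ‖quot s p (φ t) z‖ₑ ^ p ≠ ⊤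

theorem lintegral_time_space {F : ℝ × (E n × E n) → ℝ≥0∞} (hF : Measurable F) :
    ∫⁻ q, F q = ∫⁻ t, ∫⁻ z, F (t, z) := by
  rw [Measure.volume_eq_prod, lintegral_prod _ hF.aemeasurable]

theorem TestClass.memLp {s p M : ℝ} (hp : 1 < p) {Ω : Set (E n)} {φ : ℝ → E n → ℝ}
    (h : TestClass s p M Ω φ) :
    MemLp (fun q : ℝ × (E n × E n) => quot s p (φ q.1) q.2) (ENNReal.ofReal p) volume := by
  have hm := measurable_quot s p h.meas
  have hp0 : ENNReal.ofReal p ≠ 0 := by simp; linarith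
  refine ⟨hm.aestronglyMeasurable, ?_⟩
  rw [eLpNorm_lt_top_iff_lintegral_rpow_enorm_lt_top hp0 ENNReal.ofReal_ne_top,
    ENNReal.toReal_ofReal (by linarith), lintegral_time_space (hm.enorm.pow_const _)]
  exact h.seminorm.lt_top

/-- The part of `ℝⁿ × ℝⁿ` where exactly one point lies in `Ω` and the other one off `Ω'`. -/
def tailRegion (Ω Ω' : Set (E n)) : Set (E n × E n) := Ω ×ˢ Ω'ᶜ ∪ Ω'ᶜ ×ˢ Ω

theorem measurableSet_tailRegion {Ω Ω' : Set (E n)} (ho : IsOpen Ω) (ho' : IsOpen Ω') :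
    MeasurableSet (tailRegion Ω Ω') :=
  (ho.measurableSet.prod ho'.measurableSet.compl).union
    (ho'.measurableSet.compl.prod ho.measurableSet)

theorem quot_eq_zero_of_notMem {Ω Ω' : Set (E n)} (hsub : Ω ⊆ Ω') (s p : ℝ) {φ : E n → ℝ}
    (hφ : ∀ x ∉ Ω, φ x = 0) {z : E n × E n} (h1 : z ∉ Ω' ×ˢ Ω') (h2 : z ∉ tailRegion Ω Ω') :
    quot s p φ z = 0 := by
  have hz1 : z.1 ∉ Ω := fun h => by
    by_cases h' : z.2 ∈ Ω'
    · exact h1 ⟨hsub h, h'⟩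
    · exact h2 (Or.inl ⟨h, h'⟩)
  have hz2 : z.2 ∉ Ω := fun h => by
    by_cases h' : z.1 ∈ Ω'
    · exact h1 ⟨h', hsub h⟩
    · exact h2 (Or.inr ⟨h', h⟩)
  rw [quot, hφ _ hz1, hφ _ hz2, sub_zero, zero_div]

section Flux

variable {s p : ℝ} {Ω Ω' : Set (E n)} {u : ℝ → E n → ℝ}

/-- The size of the flux `J_p(quot u)` on a set of pairs of points. -/
def fluxOn (s p : ℝ) (A : Set (E n × E n)) (u : ℝ → E n → ℝ) (q : ℝ × (E n × E n)) : ℝ≥0∞ :=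
  A.indicator (fun z => ‖Jp p (quot s p (u q.1) z)‖ₑ) q.2

theorem measurable_fluxOn (s p : ℝ) {A : Set (E n × E n)} (hA : MeasurableSet A)
    (hu : Measurable (Function.uncurry u)) : Measurable (fluxOn s p A u) := by
  have h : Measurable fun q : ℝ × (E n × E n) => ‖Jp p (quot s p (u q.1) q.2)‖ₑ :=
    ((measurable_Jp p).comp (measurable_quot s p hu)).enorm
  exact h.indicator (measurable_snd hA)

theorem fluxOn_ne_top (s p : ℝ) (A : Set (E n × E n)) (u : ℝ → E n → ℝ) (q : ℝ × (E n × E n)) :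
    fluxOn s p A u q ≠ ⊤ := by
  by_cases h : q.2 ∈ A <;> simp [fluxOn, h]

theorem SolClass.lintegral_fluxOn_near (h : SolClass s p Ω' u) (hp : 1 < p) (ho' : IsOpen Ω') :
    ∫⁻ q, fluxOn s p (Ω' ×ˢ Ω') u q ^ (p / (p - 1)) ≠ ⊤ := by
  have hA : MeasurableSet (Ω' ×ˢ Ω') := ho'.measurableSet.prod ho'.measurableSet
  have hp1 : 0 < p - 1 := by linarith
  rw [lintegral_time_space ((measurable_fluxOn s p hA h.meas).pow_const _)]
  convert h.near using 3 with t
  rw [← lintegral_indicator hA]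
  refine lintegral_congr fun z => ?_
  by_cases hz : z ∈ Ω' ×ˢ Ω'
  · rw [fluxOn, indicator_of_mem hz, indicator_of_mem hz, enorm_Jp hp, ← ENNReal.rpow_mul,
      mul_div_cancel₀ _ hp1.ne']
  · rw [fluxOn, indicator_of_notMem hz, indicator_of_notMem hz,
      ENNReal.zero_rpow_of_pos (by positivity)]

theorem SolClass.lintegral_fluxOn_tail (h : SolClass s p Ω' u) (hs : 0 < s) (hp : 2 < p)
    (ho : IsOpen Ω) (hb : Bornology.IsBounded Ω) (ho' : IsOpen Ω') (hsub : closure Ω ⊆ Ω') :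
    ∫⁻ q, fluxOn s p (tailRegion Ω Ω') u q * invWeight s p q.2 ≠ ⊤ := by
  have hA := measurableSet_tailRegion ho ho'
  obtain ⟨C, hC, hle⟩ := exists_tail_bound ho hb ho' hsub hs hp
  have hF := measurable_fluxOn s p hA h.meas
  have hW := measurable_invWeight (n := n) s p
  rw [lintegral_time_space (by fun_prop)]
  refine ((lintegral_mono (g := fun t => 2 * C *
    ∫⁻ x, ‖u t x‖ₑ ^ (p - 1) ∂(tailMeasure n (s * p))) fun t => ?_).trans_lt ?_).ne
  · have hut : Measurable (u t) := h.meas.comp measurable_prodMk_left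
    calc ∫⁻ z, fluxOn s p (tailRegion Ω Ω') u (t, z) * invWeight s p z
        = ∫⁻ z in tailRegion Ω Ω', ‖Jp p (quot s p (u t) z)‖ₑ * invWeight s p z := by
          rw [← lintegral_indicator hA]
          refine lintegral_congr fun z => ?_
          by_cases hz : z ∈ tailRegion Ω Ω' <;> simp [fluxOn, hz]
      _ ≤ (∫⁻ z in Ω ×ˢ Ω'ᶜ, ‖Jp p (quot s p (u t) z)‖ₑ * invWeight s p z) +
            ∫⁻ z in Ω'ᶜ ×ˢ Ω, ‖Jp p (quot s p (u t) z)‖ₑ * invWeight s p z :=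
          lintegral_union_le _ _ _
      _ ≤ C * (∫⁻ x, ‖u t x‖ₑ ^ (p - 1) ∂(tailMeasure n (s * p))) +
            C * ∫⁻ x, ‖u t x‖ₑ ^ (p - 1) ∂(tailMeasure n (s * p)) := by
          rw [setLIntegral_swap_tail]
          exact add_le_add (hle _ hut) (hle _ hut)
      _ = _ := by ring
  · rw [lintegral_const_mul' _ _ (ENNReal.mul_ne_top (by simp) hC)]
    exact ENNReal.mul_lt_top (ENNReal.mul_lt_top (by simp) hC.lt_top) h.tail.lt_top

/-- Off the near and the tail region there is no interaction of the flux with differences of test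
functions. -/
theorem enorm_flux_mul {t : ℝ} {z : E n × E n} {d : ℝ}
    (hd : z ∉ Ω' ×ˢ Ω' → z ∉ tailRegion Ω Ω' → d = 0) :
    ‖Jp p (quot s p (u t) z)‖ₑ * ‖d‖ₑ =
      fluxOn s p (Ω' ×ˢ Ω') u (t, z) * ‖d‖ₑ + fluxOn s p (tailRegion Ω Ω') u (t, z) * ‖d‖ₑ := by
  by_cases h1 : z ∈ Ω' ×ˢ Ω'
  · have h2 : z ∉ tailRegion Ω Ω' := by
      rintro (h | h)
      · exact h.2 h1.2
      · exact h.1 h1.1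
    simp [fluxOn, h1, h2]
  · by_cases h2 : z ∈ tailRegion Ω Ω'
    · simp [fluxOn, h1, h2]
    · simp [hd h1 h2]

theorem TestClass.enorm_quot_le {M : ℝ} {φ : ℝ → E n → ℝ} (hφ : TestClass s p M Ω φ)
    (q : ℝ × (E n × E n)) :
    ‖quot s p (φ q.1) q.2‖ₑ ≤ ENNReal.ofReal (2 * M) * invWeight s p q.2 := by
  rw [enorm_quot, ← ofReal_norm, Real.norm_eq_abs]
  gcongr
  have := abs_sub (φ q.1 q.2.1) (φ q.1 q.2.2)
  linarith [hφ.bound q.1 q.2.1, hφ.bound q.1 q.2.2]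

theorem SolClass.lintegral_fluxOn_tail_mul (h : SolClass s p Ω' u) (hs : 0 < s) (hp : 2 < p)
    (ho : IsOpen Ω) (hb : Bornology.IsBounded Ω) (ho' : IsOpen Ω') (hsub : closure Ω ⊆ Ω')
    (M : ℝ) :
    ∫⁻ q, fluxOn s p (tailRegion Ω Ω') u q * (ENNReal.ofReal (2 * M) * invWeight s p q.2) ≠ ⊤ := by
  simp_rw [mul_left_comm _ (ENNReal.ofReal (2 * M))]
  rw [lintegral_const_mul' _ _ ENNReal.ofReal_ne_top]
  exact ENNReal.mul_ne_top ENNReal.ofReal_ne_top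
    (h.lintegral_fluxOn_tail hs hp ho hb ho' hsub)

/-- The flux of a solution pairs with test functions. -/
theorem SolClass.lintegral_flux_mul_ne_top (h : SolClass s p Ω' u) (hs : 0 < s) (hp : 2 < p)
    (ho : IsOpen Ω) (hb : Bornology.IsBounded Ω) (ho' : IsOpen Ω') (hsub : closure Ω ⊆ Ω')
    {M : ℝ} {φ : ℝ → E n → ℝ} (hφ : TestClass s p M Ω φ) :
    ∫⁻ q : ℝ × (E n × E n),
      ‖Jp p (quot s p (u q.1) q.2)‖ₑ * ‖quot s p (φ q.1) q.2‖ₑ ≠ ⊤ := by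
  have hsub' := subset_closure.trans hsub
  have hA : MeasurableSet (Ω' ×ˢ Ω') := ho'.measurableSet.prod ho'.measurableSet
  have hQ := measurable_quot s p hφ.meas
  have hp1 : 1 < p := by linarith
  have h1 : ∫⁻ q : ℝ × (E n × E n),
      fluxOn s p (Ω' ×ˢ Ω') u q * ‖quot s p (φ q.1) q.2‖ₑ ≠ ⊤ := by
    have hc : Real.HolderConjugate (p / (p - 1)) p :=
      (Real.HolderConjugate.conjExponent hp1).symm
    refine ((ENNReal.lintegral_mul_le_Lp_mul_Lq volume hc
      (measurable_fluxOn s p hA h.meas).aemeasurable hQ.enorm.aemeasurable).trans_lt ?_).ne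
    have hc0 := hc.pos
    refine ENNReal.mul_lt_top
      (ENNReal.rpow_lt_top_of_nonneg (by positivity) (h.lintegral_fluxOn_near hp1 ho'))
      (ENNReal.rpow_lt_top_of_nonneg (by positivity) ?_)
    rw [lintegral_time_space (hQ.enorm.pow_const _)]
    exact hφ.seminorm
  have h2 : ∫⁻ q : ℝ × (E n × E n),
      fluxOn s p (tailRegion Ω Ω') u q * ‖quot s p (φ q.1) q.2‖ₑ ≠ ⊤ :=
    ((lintegral_mono fun q => mul_le_mul_right (hφ.enorm_quot_le q) _).trans_lt
      (h.lintegral_fluxOn_tail_mul hs hp ho hb ho' hsub M).lt_top).ne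
  have hF := measurable_fluxOn s p hA h.meas
  rw [lintegral_congr fun q : ℝ × (E n × E n) =>
      enorm_flux_mul (s := s) (p := p) (u := u) fun h1 h2 =>
        quot_eq_zero_of_notMem hsub' s p (hφ.supp q.1) h1 h2,
    lintegral_add_left (by fun_prop)]
  exact ENNReal.add_ne_top.2 ⟨h1, h2⟩

/-- The pairing of the flux with the difference of a test function and its time translate tends
to zero. -/
theorem SolClass.tendsto_flux_translate (h : SolClass s p Ω' u) (hs : 0 < s) (hp : 2 < p)
    (ho : IsOpen Ω) (hb : Bornology.IsBounded Ω) (ho' : IsOpen Ω') (hsub : closure Ω ⊆ Ω')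
    {M : ℝ} {φ : ℝ → E n → ℝ} (hφ : TestClass s p M Ω φ) :
    Tendsto (fun δ : ℝ => ∫⁻ q : ℝ × (E n × E n), ‖Jp p (quot s p (u q.1) q.2)‖ₑ *
      ‖quot s p (φ (q.1 + δ)) q.2 - quot s p (φ q.1) q.2‖ₑ) (𝓝 0) (𝓝 0) := by
  have hsub' := subset_closure.trans hsub
  have hA : MeasurableSet (Ω' ×ˢ Ω') := ho'.measurableSet.prod ho'.measurableSet
  have hQ := measurable_quot s p hφ.meas
  have hp1 : 1 < p := by linarith
  have h1 := tendsto_lintegral_translate_of_Lq hp1 (hφ.memLp hp1)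
    (measurable_fluxOn s p hA h.meas) (h.lintegral_fluxOn_near hp1 ho')
  have h2 := tendsto_lintegral_translate_of_bounded hp1 hQ (hφ.memLp hp1)
    (measurable_fluxOn s p (measurableSet_tailRegion ho ho') h.meas)
    (fluxOn_ne_top s p _ u) (S := fun z => ENNReal.ofReal (2 * M) * invWeight s p z)
    hφ.enorm_quot_le
    (h.lintegral_fluxOn_tail_mul hs hp ho hb ho' hsub M)
  have h3 := h1.add h2
  rw [add_zero] at h3
  refine h3.congr fun δ => ?_
  have hQδ : Measurable fun q : ℝ × (E n × E n) => quot s p (φ (q.1 + δ)) q.2 :=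
    hQ.comp (f := fun q : ℝ × (E n × E n) => (q.1 + δ, q.2)) (by fun_prop)
  have hF := measurable_fluxOn s p hA h.meas
  dsimp only
  rw [← lintegral_add_left (by fun_prop)]
  refine lintegral_congr fun q => ?_
  exact (enorm_flux_mul (s := s) (p := p) (u := u) (t := q.1) fun h1 h2 => by
    rw [quot_eq_zero_of_notMem hsub' s p (hφ.supp _) h1 h2,
      quot_eq_zero_of_notMem hsub' s p (hφ.supp _) h1 h2, sub_zero]).symm

end Flux

/-! ### Test functions that are constant in time -/

theorem quot_congr_ae (s p : ℝ) {u v : E n → ℝ} (h : u =ᵐ[volume] v) :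
    quot s p u =ᵐ[volume] quot s p v := by
  have h1 := (Measure.quasiMeasurePreserving_fst (μ := (volume : Measure (E n)))
    (ν := (volume : Measure (E n)))).ae h
  have h2 := (Measure.quasiMeasurePreserving_snd (μ := (volume : Measure (E n)))
    (ν := (volume : Measure (E n)))).ae h
  filter_upwards [h1, h2] with z hz1 hz2
  rw [quot, quot, hz1, hz2]

theorem wNormPow_eq {s p : ℝ} (hp : 0 < p) (U : Set (E n)) (u : E n → ℝ) :
    wNormPow s p U u = (∫⁻ x in U, ‖u x‖ₑ ^ p) + ∫⁻ z in U ×ˢ U, ‖quot s p u z‖ₑ ^ p := by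
  simp_rw [enorm_quot_rpow hp]
  rfl

theorem MemW.wNormPow_lt_top {s p : ℝ} (hp : 1 < p) {U : Set (E n)} {u : E n → ℝ}
    (h : MemW s p U u) : wNormPow s p U u < ⊤ := by
  have hp0 : ENNReal.ofReal p ≠ 0 := by simp; linarith
  rw [wNormPow_eq (by linarith)]
  have h1 := (eLpNorm_lt_top_iff_lintegral_rpow_enorm_lt_top hp0 ENNReal.ofReal_ne_top).1 h.1.2
  have h2 := (eLpNorm_lt_top_iff_lintegral_rpow_enorm_lt_top hp0 ENNReal.ofReal_ne_top).1 h.2.2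
  rw [ENNReal.toReal_ofReal (by linarith)] at h1 h2
  rw [sqMeasure, Measure.prod_restrict, ← Measure.volume_eq_prod] at h2
  exact ENNReal.add_lt_top.2 ⟨h1, h2⟩

theorem isFiniteMeasure_tailMeasure {α : ℝ} (hα : 0 < α) : IsFiniteMeasure (tailMeasure n α) := by
  refine ⟨?_⟩
  have h := lintegral_tailWeight_ne_top (n := n) (r := n + α) (by linarith)
  rw [tailMeasure, withDensity_apply _ MeasurableSet.univ, Measure.restrict_univ]
  exact h.lt_top

/-- A bounded Borel function that vanishes off `Ω`, with finite Sobolev-Slobodeckii seminorm. -/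
structure SpaceTest (s p M : ℝ) (Ω : Set (E n)) (ψ : E n → ℝ) : Prop where
  meas : Measurable ψ
  bound : ∀ x, |ψ x| ≤ M
  supp : ∀ x ∉ Ω, ψ x = 0
  seminorm : ∫⁻ z, ‖quot s p ψ z‖ₑ ^ p ≠ ⊤

section SpaceTest

variable {s p M : ℝ} {Ω Ω' : Set (E n)} {ψ : E n → ℝ}

theorem SpaceTest.memLp (h : SpaceTest s p M Ω ψ) (q : ℝ≥0∞) (μ : Measure (E n))
    [IsFiniteMeasure μ] : MemLp ψ q μ :=
  MemLp.of_bound h.meas.aestronglyMeasurable M (Eventually.of_forall h.bound)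

theorem SpaceTest.mem_xZero (h : SpaceTest s p M Ω ψ) (hs : 0 < s) (hp : 1 < p)
    (hb' : Bornology.IsBounded Ω') : ψ ∈ xZero s p Ω Ω' := by
  have hp0 : ENNReal.ofReal p ≠ 0 := by simp; linarith
  have : IsFiniteMeasure (volume.restrict Ω') := ⟨by simpa using hb'.measure_lt_top⟩
  have := isFiniteMeasure_tailMeasure (n := n) (α := s * p) (by nlinarith)
  refine ⟨⟨h.memLp _ _, ?_⟩, h.memLp _ _, Eventually.of_forall h.supp⟩
  have h1 : MemLp (quot s p ψ) (ENNReal.ofReal p) volume := by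
    refine ⟨(aemeasurable_quot s p h.meas.aemeasurable).aestronglyMeasurable, ?_⟩
    rw [eLpNorm_lt_top_iff_lintegral_rpow_enorm_lt_top hp0 ENNReal.ofReal_ne_top,
      ENNReal.toReal_ofReal (by linarith)]
    exact h.seminorm.lt_top
  rw [sqMeasure, Measure.prod_restrict, ← Measure.volume_eq_prod]
  exact h1.restrict _

/-- The test function that is constant in time on `[a, b]`. -/
theorem SpaceTest.testClass (h : SpaceTest s p M Ω ψ) (hp : 1 < p) (a b : ℝ) :
    TestClass s p M Ω (fun t x => (Icc a b).indicator (fun _ => ψ x) t) := by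
  have hp0 : 0 < p := by linarith
  refine ⟨?_, fun t x => ?_, fun t x hx => ?_, ?_⟩
  · exact (h.meas.comp measurable_snd).indicator (measurable_fst measurableSet_Icc)
  · by_cases ht : t ∈ Icc a b
    · simpa [ht] using h.bound x
    · simpa [ht] using (abs_nonneg _).trans (h.bound x)
  · by_cases ht : t ∈ Icc a b <;> simp [ht, h.supp x hx]
  · have h1 : ∀ t, ∫⁻ z, ‖quot s p (fun x => (Icc a b).indicator (fun _ => ψ x) t) z‖ₑ ^ p =
        (Icc a b).indicator (fun _ => ∫⁻ z, ‖quot s p ψ z‖ₑ ^ p) t := by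
      intro t
      by_cases ht : t ∈ Icc a b
      · simp [ht]
      · simp [ht, quot, hp0]
    simp_rw [h1]
    rw [lintegral_indicator measurableSet_Icc, setLIntegral_const]
    exact ENNReal.mul_ne_top h.seminorm (by simp)

theorem SpaceTest.isTest (h : SpaceTest s p M Ω ψ) (hs : 0 < s) (hp : 1 < p)
    (hb : Bornology.IsBounded Ω) (hb' : Bornology.IsBounded Ω') (a b : ℝ) :
    ∃ Φ : L2 Ω, IsTest s p Ω Ω' (Icc a b) (fun _ => ψ) (fun _ => Φ) := by
  have : IsFiniteMeasure (volume.restrict Ω) := ⟨by simpa using hb.measure_lt_top⟩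
  have hx := h.mem_xZero hs hp hb' (Ω' := Ω')
  refine ⟨(h.memLp 2 _).toLp ψ, ⟨(h.meas.comp measurable_snd).aestronglyMeasurable,
    Eventually.of_forall fun _ => hx.1, ?_⟩, Eventually.of_forall fun _ => hx,
    fun t _ => (MemLp.coeFn_toLp _).symm, contDiffOn_const⟩
  rw [setLIntegral_const]
  exact ENNReal.mul_lt_top (hx.1.wNormPow_lt_top hp) (by simp)

/-- The weak formulation for test functions that do not depend on time. -/
theorem IsWeakSolution.flux_eq [Fact (1 < p)] {f : ℝ → XZeroDual s p Ω Ω'} {u : ℝ → E n → ℝ}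
    (hu : IsWeakSolution s p Ω Ω' f u) (h : SpaceTest s p M Ω ψ) (hs : 0 < s)
    (hb : Bornology.IsBounded Ω) (hb' : Bornology.IsBounded Ω') {a b : ℝ} (ha : 0 < a)
    (hab : a < b) :
    ∫ t in Icc a b, ∫ z, Jp p (quot s p (u t) z) * quot s p ψ z =
      (∫ x in Ω, u a x * ψ x) - (∫ x in Ω, u b x * ψ x)
        + ∫ t in Icc a b, pairing (f t) ψ := by
  have hp : 1 < p := Fact.out
  obtain ⟨Φ, hΦ⟩ := h.isTest hs hp hb hb' a b
  have h1 := hu.equation a b ha hab _ _ hΦ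
  have h2 : ∫ t in Icc a b, ∫ x in Ω, u t x * (derivWithin (fun _ => Φ) (Icc a b) t) x = 0 := by
    rw [← integral_zero ℝ ℝ (μ := volume.restrict (Icc a b))]
    refine integral_congr_ae (Eventually.of_forall fun t => ?_)
    have h3 : ∫ x in Ω, u t x * (derivWithin (fun _ => Φ) (Icc a b) t) x =
        ∫ x in Ω, (0 : ℝ) := by
      refine integral_congr_ae ?_
      filter_upwards [Lp.coeFn_zero ℝ 2 (volume.restrict Ω)] with x hx
      rw [derivWithin_fun_const, Pi.zero_apply, hx, Pi.zero_apply, mul_zero]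
    beta_reduce
    rw [h3, integral_zero]
  rw [h2, neg_zero, zero_add] at h1
  simp_rw [Jp_quot_mul_quot hp]
  exact h1

theorem IsWeakSolution.memLp_two [Fact (1 < p)] {f : ℝ → XZeroDual s p Ω Ω'} {u : ℝ → E n → ℝ}
    (hu : IsWeakSolution s p Ω Ω' f u) {t : ℝ} (ht : 0 < t) :
    MemLp (u t) 2 (volume.restrict Ω) := by
  obtain ⟨U, hU, -⟩ := hu.continuous_L2 t (t + 1) ht (by linarith)
  have h := hU t ⟨le_rfl, by linarith⟩
  exact (memLp_congr_ae h).2 (Lp.memLp (U t))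

theorem SolClass.integrable_flux_mul {u φ : ℝ → E n → ℝ} (h : SolClass s p Ω' u) (hs : 0 < s)
    (hp : 2 < p) (ho : IsOpen Ω) (hb : Bornology.IsBounded Ω) (ho' : IsOpen Ω')
    (hsub : closure Ω ⊆ Ω') (hφ : TestClass s p M Ω φ) :
    Integrable (fun q : ℝ × (E n × E n) =>
      Jp p (quot s p (u q.1) q.2) * quot s p (φ q.1) q.2) volume := by
  have h1 : Measurable fun q : ℝ × (E n × E n) => Jp p (quot s p (u q.1) q.2) :=
    (measurable_Jp p).comp (measurable_quot s p h.meas)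
  refine ⟨(h1.mul (measurable_quot s p hφ.meas)).aestronglyMeasurable, ?_⟩
  rw [hasFiniteIntegral_iff_enorm]
  simp_rw [enorm_mul]
  exact (h.lintegral_flux_mul_ne_top hs hp ho hb ho' hsub hφ).lt_top

theorem SolClass.integrableOn_flux_mul {u : ℝ → E n → ℝ} (h : SolClass s p Ω' u) (hs : 0 < s)
    (hp : 2 < p) (ho : IsOpen Ω) (hb : Bornology.IsBounded Ω) (ho' : IsOpen Ω')
    (hsub : closure Ω ⊆ Ω') (hψ : SpaceTest s p M Ω ψ) (a b : ℝ) :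
    Integrable (fun q : ℝ × (E n × E n) => Jp p (quot s p (u q.1) q.2) * quot s p ψ q.2)
      ((volume.restrict (Icc a b)).prod volume) := by
  have h1 := h.integrable_flux_mul hs hp ho hb ho' hsub (hψ.testClass (by linarith) a b)
  have h2 : (volume.restrict (Icc a b)).prod (volume : Measure (E n × E n)) =
      volume.restrict (Icc a b ×ˢ univ) := by
    rw [Measure.volume_eq_prod ℝ (E n × E n), ← Measure.prod_restrict, Measure.restrict_univ]
  rw [h2]
  refine (h1.restrict (s := Icc a b ×ˢ univ)).congr ?_
  filter_upwards [ae_restrict_mem (measurableSet_Icc.prod MeasurableSet.univ)] with q hq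
  simp [hq.1]

/-- The equation for the difference `u - v`, tested with a function that does not depend on
time. The integrals of the fluxes are written with Borel representatives `u₀`, `v₀`. -/
theorem IsWeakSolution.flux_sub_eq [Fact (1 < p)] {f : ℝ → XZeroDual s p Ω Ω'}
    {u v u₀ v₀ : ℝ → E n → ℝ}
    (hu : IsWeakSolution s p Ω Ω' f u) (hv : IsWeakSolution s p Ω Ω' f v)
    (hu₀ : SolClass s p Ω' u₀) (hv₀ : SolClass s p Ω' v₀) (hs : 0 < s) (hp : 2 < p)
    (ho : IsOpen Ω) (hb : Bornology.IsBounded Ω) (ho' : IsOpen Ω')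
    (hb' : Bornology.IsBounded Ω') (hsub : closure Ω ⊆ Ω') (hψ : SpaceTest s p M Ω ψ)
    {a b : ℝ} (ha : 0 < a) (hab : a < b)
    (hueq : ∀ᵐ t ∂(volume.restrict (Icc a b)), u₀ t =ᵐ[volume] u t)
    (hveq : ∀ᵐ t ∂(volume.restrict (Icc a b)), v₀ t =ᵐ[volume] v t) :
    ∫ q, (Jp p (quot s p (u₀ q.1) q.2) - Jp p (quot s p (v₀ q.1) q.2)) * quot s p ψ q.2
        ∂((volume.restrict (Icc a b)).prod volume) =
      ∫ x in Ω, ψ x * ((u a x - v a x) - (u b x - v b x)) := by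
  have : IsFiniteMeasure (volume.restrict Ω) := ⟨by simpa using hb.measure_lt_top⟩
  have hui := hu₀.integrableOn_flux_mul hs hp ho hb ho' hsub hψ a b
  have hvi := hv₀.integrableOn_flux_mul hs hp ho hb ho' hsub hψ a b
  have key : ∀ {u u₀ : ℝ → E n → ℝ},
      (∀ᵐ t ∂(volume.restrict (Icc a b)), u₀ t =ᵐ[volume] u t) →
      ∫ t in Icc a b, ∫ z, Jp p (quot s p (u₀ t) z) * quot s p ψ z =
        ∫ t in Icc a b, ∫ z, Jp p (quot s p (u t) z) * quot s p ψ z := by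
    intro u u₀ h
    refine integral_congr_ae ?_
    filter_upwards [h] with t ht
    refine integral_congr_ae ?_
    filter_upwards [quot_congr_ae s p ht] with z hz
    rw [hz]
  have hb0 : 0 < b := ha.trans hab
  have hint : ∀ {u : ℝ → E n → ℝ}, IsWeakSolution s p Ω Ω' f u → ∀ t, 0 < t →
      Integrable (fun x => u t x * ψ x) (volume.restrict Ω) := fun h t ht =>
    (h.memLp_two ht).integrable_mul (hψ.memLp 2 _)
  simp_rw [sub_mul]
  rw [integral_sub hui hvi, integral_prod _ hui, integral_prod _ hvi]
  dsimp only
  rw [key hueq, key hveq, hu.flux_eq hψ hs hb hb' ha hab, hv.flux_eq hψ hs hb hb' ha hab]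
  have hintd : ∀ t, 0 < t → Integrable (fun x => u t x * ψ x - v t x * ψ x)
      (volume.restrict Ω) := fun t ht => (hint hu t ht).sub (hint hv t ht)
  have h1 : ∫ x in Ω, ψ x * ((u a x - v a x) - (u b x - v b x)) =
      ((∫ x in Ω, u a x * ψ x) - ∫ x in Ω, v a x * ψ x) -
        ((∫ x in Ω, u b x * ψ x) - ∫ x in Ω, v b x * ψ x) := by
    rw [← integral_sub (hint hu a ha) (hint hv a ha),
      ← integral_sub (hint hu b hb0) (hint hv b hb0),
      ← integral_sub (hintd a ha) (hintd b hb0)]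
    refine integral_congr_ae (Eventually.of_forall fun x => ?_)
    ring
  rw [h1]
  ring

end SpaceTest

/-! ### Truncations, and an energy inequality from short increments -/

/-- The truncation `min((r - k)₊, M)`. -/
def trunc (k M r : ℝ) : ℝ := max 0 (min (r - k) M)

/-- The primitive of `trunc k M`, a convex function with quadratic growth near `k` and linear
growth at infinity. -/
def truncPrim (k M r : ℝ) : ℝ := ∫ x in (0 : ℝ)..r, trunc k M x

section trunc

variable {k M : ℝ}

theorem continuous_trunc (k M : ℝ) : Continuous (trunc k M) := by
  unfold trunc
  fun_prop

theorem monotone_trunc (k M : ℝ) : Monotone (trunc k M) := fun a b hab => by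
  unfold trunc
  gcongr

theorem trunc_nonneg (k M r : ℝ) : 0 ≤ trunc k M r := le_max_left _ _

theorem trunc_le (hM : 0 ≤ M) (k r : ℝ) : trunc k M r ≤ M := max_le hM (min_le_right _ _)

theorem trunc_le_max (k M r : ℝ) : trunc k M r ≤ max 0 (r - k) :=
  max_le_max le_rfl (min_le_left _ _)

theorem trunc_of_le {r : ℝ} (M : ℝ) (h : r ≤ k) : trunc k M r = 0 :=
  max_eq_left ((min_le_left _ _).trans (by linarith))

theorem abs_trunc_sub_le (k M a b : ℝ) : |trunc k M a - trunc k M b| ≤ |a - b| := by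
  unfold trunc
  refine (abs_max_sub_max_le_max _ _ _ _).trans ?_
  rw [sub_self, abs_zero, max_eq_right (abs_nonneg _)]
  refine (abs_min_sub_min_le_max _ _ _ _).trans ?_
  rw [sub_self, abs_zero, max_eq_left (abs_nonneg _)]
  simp

theorem trunc_sub_mul_nonneg (k M a b : ℝ) : 0 ≤ (trunc k M a - trunc k M b) * (a - b) := by
  rcases le_total a b with h | h
  · exact mul_nonneg_of_nonpos_of_nonpos (sub_nonpos.2 (monotone_trunc k M h)) (sub_nonpos.2 h)
  · exact mul_nonneg (sub_nonneg.2 (monotone_trunc k M h)) (sub_nonneg.2 h)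

/-- Convexity of `truncPrim`. -/
theorem truncPrim_sub_le (k M r q : ℝ) :
    truncPrim k M r - truncPrim k M q ≤ trunc k M r * (r - q) := by
  have hi : ∀ a b, IntervalIntegrable (trunc k M) volume a b := fun a b =>
    (continuous_trunc k M).intervalIntegrable a b
  rw [truncPrim, truncPrim, intervalIntegral.integral_interval_sub_left (hi _ _) (hi _ _)]
  rcases le_total q r with h | h
  · have h1 := intervalIntegral.integral_mono_on h (hi q r)
      (intervalIntegrable_const (c := trunc k M r)) fun x hx => monotone_trunc k M hx.2
    rw [intervalIntegral.integral_const, smul_eq_mul] at h1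
    linarith
  · have h1 := intervalIntegral.integral_mono_on h
      (intervalIntegrable_const (c := trunc k M r)) (hi r q) fun x hx => monotone_trunc k M hx.1
    rw [intervalIntegral.integral_const, smul_eq_mul] at h1
    rw [intervalIntegral.integral_symm]
    linarith

theorem truncPrim_zero (k M : ℝ) : truncPrim k M 0 = 0 := by simp [truncPrim]

theorem truncPrim_nonneg (hk : 0 ≤ k) (M r : ℝ) : 0 ≤ truncPrim k M r := by
  have h := truncPrim_sub_le k M 0 r
  rw [trunc_of_le M hk, zero_mul, truncPrim_zero] at h
  linarith

theorem truncPrim_le (k M r : ℝ) : truncPrim k M r ≤ max 0 (r - k) ^ 2 := by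
  have h1 := truncPrim_sub_le k M r k
  have h2 := truncPrim_sub_le k M k 0
  rw [trunc_of_le M le_rfl, zero_mul, truncPrim_zero] at h2
  have h3 := trunc_le_max k M r
  have h4 := trunc_nonneg k M r
  rcases le_total r k with h | h
  · rw [trunc_of_le M h, zero_mul] at h1
    nlinarith [sq_nonneg (max 0 (r - k))]
  · rw [max_eq_right (sub_nonneg.2 h)] at h3 ⊢
    nlinarith

/-- Lower bound of the primitive above a higher level. -/
theorem le_truncPrim {k' r : ℝ} (hk : 0 ≤ k) (hkk : k < k') (hM : k' - k ≤ M) (hr : k' ≤ r) :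
    (k' - k) ^ 2 / 4 ≤ truncPrim k M r := by
  set m := (k + k') / 2 with hm
  have h1 := truncPrim_sub_le k M m r
  have h2 := truncPrim_nonneg hk M m
  have h3 : trunc k M m = (k' - k) / 2 := by
    rw [trunc, min_eq_left (by linarith), max_eq_right (by linarith)]
    linarith
  rw [h3] at h1
  nlinarith

theorem abs_truncPrim_sub_le (hM : 0 ≤ M) (k r q : ℝ) :
    |truncPrim k M r - truncPrim k M q| ≤ M * |r - q| := by
  have key : ∀ r q, truncPrim k M r - truncPrim k M q ≤ M * |r - q| := fun r q =>
    (truncPrim_sub_le k M r q).trans <|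
      (mul_le_mul_of_nonneg_left (le_abs_self _) (trunc_nonneg _ _ _)).trans
        (mul_le_mul_of_nonneg_right (trunc_le hM k r) (abs_nonneg _))
  rw [abs_le]
  constructor
  · have := key q r
    rw [abs_sub_comm] at this
    linarith
  · exact key r q

end trunc

/-- Transfer of a pointwise bound to integrals when one of the functions is only known through
its Bochner integral. -/
theorem ofReal_add_lintegral_le {α : Type*} [MeasurableSpace α] {μ : Measure α} {f : α → ℝ}
    (hf : Integrable f μ) {g N : α → ℝ≥0∞} (hg : AEMeasurable g μ)
    (h : ∀ q, g q + ENNReal.ofReal (-f q) ≤ ENNReal.ofReal (f q) + N q) {e₀ e₁ : ℝ}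
    (he₀ : 0 ≤ e₀) (he₁ : 0 ≤ e₁) (he : e₁ - e₀ ≤ -∫ q, f q ∂μ) :
    ENNReal.ofReal e₁ + ∫⁻ q, g q ∂μ ≤ ENNReal.ofReal e₀ + ∫⁻ q, N q ∂μ := by
  set A := ∫⁻ q, ENNReal.ofReal (f q) ∂μ with hA
  set B := ∫⁻ q, ENNReal.ofReal (-f q) ∂μ with hB
  have hAtop : A ≠ ⊤ := hf.lintegral_lt_top.ne
  have hBtop : B ≠ ⊤ := hf.neg.lintegral_lt_top.ne
  have hmf : AEMeasurable (fun q => ENNReal.ofReal (f q)) μ := hf.1.aemeasurable.ennreal_ofReal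
  have h1 : ∫⁻ q, g q ∂μ + B ≤ A + ∫⁻ q, N q ∂μ := by
    rw [hA, hB, ← lintegral_add_left' hg, ← lintegral_add_left' hmf]
    exact lintegral_mono h
  have h2 : ENNReal.ofReal e₁ + A ≤ ENNReal.ofReal e₀ + B := by
    rw [integral_eq_lintegral_pos_part_sub_lintegral_neg_part hf] at he
    rw [← ENNReal.ofReal_toReal hAtop, ← ENNReal.ofReal_toReal hBtop,
      ← ENNReal.ofReal_add he₁ ENNReal.toReal_nonneg,
      ← ENNReal.ofReal_add he₀ ENNReal.toReal_nonneg]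
    exact ENNReal.ofReal_le_ofReal (by linarith)
  have h3 := add_le_add h2 h1
  have h4 : A + B ≠ ⊤ := ENNReal.add_ne_top.2 ⟨hAtop, hBtop⟩
  refine (ENNReal.add_le_add_iff_right h4).1 ?_
  calc _ = ENNReal.ofReal e₁ + A + (∫⁻ q, g q ∂μ + B) := by ring
    _ ≤ _ := h3
    _ = _ := by ring

theorem setLIntegral_Icc_add (f : ℝ → ℝ≥0∞) (a b h : ℝ) :
    ∫⁻ t in Icc a b, f (t + h) = ∫⁻ t in Icc (a + h) (b + h), f t := by
  have h1 := (measurePreserving_add_right volume h).setLIntegral_comp_preimage_emb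
    (measurableEmbedding_addRight h) f (Icc (a + h) (b + h))
  rw [← h1]
  simp

theorem setLIntegral_Icc_moving (f : ℝ → ℝ≥0∞) (t h : ℝ) :
    ∫⁻ τ in Icc t (t + h), f τ = ∫⁻ r in Icc 0 h, f (t + r) := by
  have h1 := setLIntegral_Icc_add f 0 h t
  rw [zero_add, add_comm h t] at h1
  rw [← h1]
  simp_rw [add_comm t]

/-- If the increments of `E` over all short time steps are bounded by a dissipation `N` up to an
error that vanishes with the time step, then `E` dissipates at least `N`. The hypothesis is averaged
over the starting time `t`: the values of `E` telescope up to boundary layers, and the error enters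
only through its integral in `t`. -/
theorem energy_le_of_increments {a b : ℝ} (hab : a < b) {E : ℝ → ℝ} (hE0 : ∀ t, 0 ≤ E t)
    (hE : ContinuousOn E (Icc a (b + 1))) {N : ℝ → ℝ≥0∞} (hN : Measurable N)
    {R : ℝ → ℝ → ℝ≥0∞} (hR : Measurable (Function.uncurry R))
    (hlim : Tendsto (fun δ => ∫⁻ τ, R τ δ) (𝓝 0) (𝓝 0))
    (hstep : ∀ h, 0 < h → h ≤ 1 → ∀ᵐ t ∂(volume.restrict (Icc a b)),
      ENNReal.ofReal (E (t + h)) + ∫⁻ τ in Icc t (t + h), N τ ≤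
        ENNReal.ofReal (E t) + ∫⁻ τ in Icc t (t + h), R τ (t + h - τ)) :
    ENNReal.ofReal (E b) + ∫⁻ t in Icc a b, N t ≤ ENNReal.ofReal (E a) := by
  have key : ∀ η, 0 < η → ∀ ε : ℝ, 0 < ε →
      ENNReal.ofReal (E b) + ∫⁻ t in Icc (a + η) b, N t ≤
        ENNReal.ofReal (E a) + ENNReal.ofReal (3 * ε) := by
    intro η hη ε hε
    have hεR : ∀ᶠ δ in 𝓝 (0 : ℝ), ∫⁻ τ, R τ δ ≤ ENNReal.ofReal ε :=
      (hlim.eventually_lt_const (by simpa using hε)).mono fun _ h => h.le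
    obtain ⟨h₁, hh₁, hR₁⟩ := Metric.eventually_nhds_iff.1 hεR
    obtain ⟨h₂, hh₂, hE₂⟩ := Metric.continuousOn_iff.1 hE b ⟨hab.le, by linarith⟩ ε hε
    obtain ⟨h₃, hh₃, hE₃⟩ := Metric.continuousOn_iff.1 hE a ⟨le_rfl, by linarith⟩ ε hε
    obtain ⟨h, hh0, hh⟩ : ∃ h, 0 < h ∧ (h < h₁ ∧ h < h₂ ∧ h < h₃ ∧ h < η ∧ h < 1 ∧ h < b - a) := by
      obtain ⟨h, h0, h'⟩ := exists_between
        (show (0 : ℝ) < min h₁ (min h₂ (min h₃ (min η (min 1 (b - a))))) by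
          simp only [lt_min_iff]
          exact ⟨hh₁, hh₂, hh₃, hη, one_pos, by linarith⟩)
      simp only [lt_min_iff] at h'
      exact ⟨h, h0, h'⟩
    obtain ⟨hhh₁, hhh₂, hhh₃, hhη, hh1, hhba⟩ := hh
    have hint := lintegral_mono_ae (hstep h hh0 hh1.le)
    set X := ∫⁻ t in Ioc (a + h) b, ENNReal.ofReal (E t) with hX
    have hXtop : X ≠ ⊤ := by
      obtain ⟨C, hC⟩ := (isCompact_Icc.image_of_continuousOn hE).bddAbove
      have h1 : X ≤ ∫⁻ _ in Ioc (a + h) b, ENNReal.ofReal C := by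
        refine setLIntegral_mono' measurableSet_Ioc fun t ht => ENNReal.ofReal_le_ofReal ?_
        exact hC ⟨t, ⟨by linarith [ht.1], by linarith [ht.2]⟩, rfl⟩
      refine (h1.trans_lt ?_).ne
      rw [setLIntegral_const]
      exact ENNReal.mul_lt_top ENNReal.ofReal_lt_top (by simp)
    have hE1m : AEMeasurable (fun t => ENNReal.ofReal (E (t + h)))
        (volume.restrict (Icc a b)) := by
      refine ((ContinuousOn.comp hE (f := fun t => t + h) (by fun_prop) ?_).aemeasurable
        measurableSet_Icc).ennreal_ofReal
      exact fun t ht => ⟨by linarith [ht.1], by linarith [ht.2]⟩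
    have hEm : AEMeasurable (fun t => ENNReal.ofReal (E t)) (volume.restrict (Icc a b)) :=
      ((hE.mono (Icc_subset_Icc_right (by linarith))).aemeasurable
        measurableSet_Icc).ennreal_ofReal
    -- the increments telescope: only the two boundary layers of `E` remain
    have hL : ENNReal.ofReal h * ENNReal.ofReal (E b - ε) + X ≤
        ∫⁻ t in Icc a b, ENNReal.ofReal (E (t + h)) := by
      rw [setLIntegral_Icc_add (fun t => ENNReal.ofReal (E t))]
      have h1 : Ioc b (b + h) ∪ Ioc (a + h) b ⊆ Icc (a + h) (b + h) := by
        rintro t (ht | ht)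
        · exact ⟨by linarith [ht.1], ht.2⟩
        · exact ⟨ht.1.le, by linarith [ht.2]⟩
      refine le_trans ?_ (lintegral_mono_set h1)
      have h2 : Disjoint (Ioc b (b + h)) (Ioc (a + h) b) := by
        rw [disjoint_left]
        exact fun t ht ht' => not_lt.2 ht'.2 ht.1
      rw [lintegral_union measurableSet_Ioc h2]
      gcongr
      calc ENNReal.ofReal h * ENNReal.ofReal (E b - ε)
          = ∫⁻ _ in Ioc b (b + h), ENNReal.ofReal (E b - ε) := by
            rw [setLIntegral_const, Real.volume_Ioc, mul_comm]
            congr 2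
            ring
        _ ≤ _ := by
            refine setLIntegral_mono' measurableSet_Ioc fun t ht => ENNReal.ofReal_le_ofReal ?_
            have h3 := hE₂ t ⟨by linarith [ht.1], by linarith [ht.2]⟩ (by
              rw [Real.dist_eq, abs_lt]
              constructor <;> linarith [ht.1, ht.2])
            rw [Real.dist_eq, abs_lt] at h3
            linarith [h3.1]
    have hRt : ∫⁻ t in Icc a b, ENNReal.ofReal (E t) ≤
        ENNReal.ofReal h * ENNReal.ofReal (E a + ε) + X := by
      have h1 : Icc a b ⊆ Icc a (a + h) ∪ Ioc (a + h) b := by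
        intro t ht
        rcases le_or_gt t (a + h) with h' | h'
        · exact Or.inl ⟨ht.1, h'⟩
        · exact Or.inr ⟨h', ht.2⟩
      refine (lintegral_mono_set h1).trans ((lintegral_union_le _ _ _).trans ?_)
      gcongr
      calc _ ≤ ∫⁻ _ in Icc a (a + h), ENNReal.ofReal (E a + ε) := by
            refine setLIntegral_mono' measurableSet_Icc fun t ht => ENNReal.ofReal_le_ofReal ?_
            have h3 := hE₃ t ⟨by linarith [ht.1], by linarith [ht.2]⟩ (by
              rw [Real.dist_eq, abs_lt]
              constructor <;> linarith [ht.1, ht.2])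
            rw [Real.dist_eq, abs_lt] at h3
            linarith [h3.2]
        _ = _ := by
            rw [setLIntegral_const, Real.volume_Icc, mul_comm]
            congr 2
            ring
    have hNl : ENNReal.ofReal h * ∫⁻ t in Icc (a + η) b, N t ≤
        ∫⁻ t in Icc a b, ∫⁻ τ in Icc t (t + h), N τ := by
      simp_rw [setLIntegral_Icc_moving N]
      rw [lintegral_lintegral_swap (by fun_prop)]
      calc ENNReal.ofReal h * ∫⁻ t in Icc (a + η) b, N t
          = ∫⁻ _ in Icc 0 h, ∫⁻ t in Icc (a + η) b, N t := by
            rw [setLIntegral_const, Real.volume_Icc, mul_comm, sub_zero]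
        _ ≤ _ := by
            refine setLIntegral_mono' measurableSet_Icc fun r hr => ?_
            rw [setLIntegral_Icc_add N]
            exact lintegral_mono_set
              (Icc_subset_Icc (by linarith [hr.2]) (by linarith [hr.1]))
    have hRr : ∫⁻ t in Icc a b, ∫⁻ τ in Icc t (t + h), R τ (t + h - τ) ≤
        ENNReal.ofReal h * ENNReal.ofReal ε := by
      have h1 : ∀ t, ∫⁻ τ in Icc t (t + h), R τ (t + h - τ) =
          ∫⁻ r in Icc 0 h, R (t + r) (h - r) := by
        intro t
        rw [setLIntegral_Icc_moving (fun τ => R τ (t + h - τ))]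
        refine lintegral_congr fun r => ?_
        congr 1
        ring
      have h2 : Measurable fun x : ℝ × ℝ => R (x.1 + x.2) (h - x.2) :=
        hR.comp (f := fun x : ℝ × ℝ => (x.1 + x.2, h - x.2)) (by fun_prop)
      simp_rw [h1]
      rw [lintegral_lintegral_swap h2.aemeasurable]
      calc _ ≤ ∫⁻ _ in Icc 0 h, ENNReal.ofReal ε := by
            refine setLIntegral_mono' measurableSet_Icc fun r hr => ?_
            refine (setLIntegral_le_lintegral _ _).trans ?_
            rw [lintegral_add_right_eq_self (fun τ => R τ (h - r))]
            refine hR₁ ?_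
            rw [Real.dist_eq, sub_zero, abs_lt]
            constructor <;> linarith [hr.1, hr.2]
        _ = _ := by rw [setLIntegral_const, Real.volume_Icc, mul_comm, sub_zero]
    rw [lintegral_add_left' hE1m, lintegral_add_left' hEm] at hint
    have h1 := (add_le_add hL hNl).trans (hint.trans (add_le_add hRt hRr))
    have hhR : ENNReal.ofReal h ≠ 0 := by simpa using hh0
    have h2 : ENNReal.ofReal (E b - ε) + ∫⁻ t in Icc (a + η) b, N t ≤
        ENNReal.ofReal (E a + ε) + ENNReal.ofReal ε := by
      refine (ENNReal.mul_le_mul_iff_right hhR ENNReal.ofReal_ne_top).1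
        ((ENNReal.add_le_add_iff_right hXtop).1 ?_)
      calc _ = ENNReal.ofReal h * ENNReal.ofReal (E b - ε) + X +
            ENNReal.ofReal h * ∫⁻ t in Icc (a + η) b, N t := by ring
        _ ≤ _ := h1
        _ = _ := by ring
    calc ENNReal.ofReal (E b) + ∫⁻ t in Icc (a + η) b, N t
        ≤ ENNReal.ofReal (E b - ε) + ENNReal.ofReal ε + ∫⁻ t in Icc (a + η) b, N t := by
          gcongr
          refine le_trans (ENNReal.ofReal_le_ofReal ?_) ENNReal.ofReal_add_le
          linarith
      _ = (ENNReal.ofReal (E b - ε) + ∫⁻ t in Icc (a + η) b, N t) + ENNReal.ofReal ε := by ring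
      _ ≤ ENNReal.ofReal (E a + ε) + ENNReal.ofReal ε + ENNReal.ofReal ε := by gcongr
      _ = ENNReal.ofReal (E a) + ENNReal.ofReal (3 * ε) := by
          rw [← ENNReal.ofReal_add (by linarith [hE0 a]) hε.le,
            ← ENNReal.ofReal_add (by linarith [hE0 a]) hε.le,
            ← ENNReal.ofReal_add (hE0 a) (by linarith)]
          congr 1
          ring
  have key2 : ∀ η, 0 < η →
      ENNReal.ofReal (E b) + ∫⁻ t in Icc (a + η) b, N t ≤ ENNReal.ofReal (E a) := by
    intro η hη
    refine ENNReal.le_of_forall_pos_le_add fun ε hε _ => ?_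
    have h1 := key η hη (ε / 3) (by positivity)
    rwa [mul_div_cancel₀ _ (by norm_num), ENNReal.ofReal_coe_nnreal] at h1
  have h1 : Tendsto (fun m : ℕ => ∫⁻ t in Icc (a + 1 / ((m : ℝ) + 1)) b, N t) atTop
      (𝓝 (∫⁻ t in ⋃ m : ℕ, Icc (a + 1 / ((m : ℝ) + 1)) b, N t)) := by
    rw [← withDensity_apply _ (MeasurableSet.iUnion fun _ => measurableSet_Icc)]
    simp_rw [← withDensity_apply N measurableSet_Icc]
    refine tendsto_measure_iUnion_atTop fun i j hij => Icc_subset_Icc_left ?_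
    gcongr
  have h2 : ⋃ m : ℕ, Icc (a + 1 / ((m : ℝ) + 1)) b = Ioc a b := by
    ext t
    simp only [mem_iUnion, mem_Icc, mem_Ioc]
    constructor
    · rintro ⟨m, hm, hb⟩
      have : 0 < 1 / ((m : ℝ) + 1) := by positivity
      exact ⟨by linarith, hb⟩
    · rintro ⟨ha, hb⟩
      obtain ⟨m, hm⟩ := exists_nat_one_div_lt (sub_pos.2 ha)
      exact ⟨m, by linarith, hb⟩
  rw [h2, Measure.restrict_congr_set Ioc_ae_eq_Icc] at h1
  refine le_of_tendsto' (h1.const_add (ENNReal.ofReal (E b))) fun m => key2 _ (by positivity)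

/-! ### The energy inequality -/

/-- A function in the closure of `C_0^∞(Ω)` vanishes almost everywhere off `Ω`. -/
theorem MemW0.ae_eq_zero {s p : ℝ} (hp : 1 < p) {Ω : Set (E n)} (ho : IsOpen Ω) {w : E n → ℝ}
    (h : MemW0 s p Ω w) : ∀ᵐ x, x ∉ Ω → w x = 0 := by
  have hm : AEMeasurable w (volume.restrict Ωᶜ) := by
    have := h.1.1.1.aemeasurable
    rw [Measure.restrict_univ] at this
    exact this.restrict
  have h0 : ∫⁻ x in Ωᶜ, ‖w x‖ₑ ^ p = 0 := by
    refine nonpos_iff_eq_zero.1 (le_of_forall_gt fun ε hε => ?_)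
    obtain ⟨g, -, -, hg, hε'⟩ := h.2 ε hε
    refine lt_of_le_of_lt ?_ hε'
    have h1 : ∫⁻ x in Ωᶜ, ‖w x‖ₑ ^ p = ∫⁻ x in Ωᶜ, ‖w x - g x‖ₑ ^ p := by
      refine setLIntegral_congr_fun ho.measurableSet.compl fun x hx => ?_
      have : g x = 0 := image_eq_zero_of_notMem_tsupport fun h' => hx (hg h')
      simp only [this, sub_zero]
    rw [h1, wNormPow, Measure.restrict_univ]
    exact (setLIntegral_le_lintegral _ _).trans le_self_add
  rw [lintegral_eq_zero_iff' (hm.enorm.pow_const p), EventuallyEq,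
    ae_restrict_iff' ho.measurableSet.compl] at h0
  filter_upwards [h0] with x hx hxΩ
  have h1 := hx hxΩ
  rw [Pi.zero_apply, ENNReal.rpow_eq_zero_iff_of_pos (by linarith), enorm_eq_zero] at h1
  exact h1

/-- A jointly measurable function has a Borel representative that vanishes off the time interval
and off a given Borel set on which it vanishes almost everywhere. -/
theorem JointMeas.exists_rep {J : Set ℝ} (hJ : MeasurableSet J) {u : ℝ → E n → ℝ}
    (hu : JointMeas J u) {A : Set (E n)} (hA : MeasurableSet A)
    (h0 : ∀ᵐ t ∂(volume.restrict J), ∀ᵐ x, x ∉ A → u t x = 0) :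
    ∃ u₀ : ℝ → E n → ℝ, Measurable (Function.uncurry u₀) ∧ (∀ t ∉ J, u₀ t = 0) ∧
      (∀ t, ∀ x ∉ A, u₀ t x = 0) ∧ ∀ᵐ t ∂(volume.restrict J), u₀ t =ᵐ[volume] u t := by
  refine ⟨fun t x => (J ×ˢ A).indicator (hu.mk _) (t, x), ?_, fun t ht => ?_, fun t x hx => ?_, ?_⟩
  · exact (hu.stronglyMeasurable_mk.measurable.indicator (hJ.prod hA))
  · ext x
    simp [ht]
  · simp [hx]
  · filter_upwards [Measure.ae_ae_of_ae_prod hu.ae_eq_mk, h0, ae_restrict_mem hJ] with t ht h0t htJ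
    filter_upwards [ht, h0t] with x hx h0x
    by_cases hxA : x ∈ A
    · rw [indicator_of_mem (show (t, x) ∈ J ×ˢ A from ⟨htJ, hxA⟩), ← hx]
    · rw [indicator_of_notMem fun h : (t, x) ∈ J ×ˢ A => hxA h.2, h0x hxA]

theorem lintegral_eq_setLIntegral_of_eq_zero {J : Set ℝ} {F : ℝ → ℝ≥0∞}
    (h : ∀ t ∉ J, F t = 0) : ∫⁻ t, F t = ∫⁻ t in J, F t := by
  refine (setLIntegral_eq_of_support_subset fun t ht => ?_).symm
  by_contra hJ
  exact ht (h t hJ)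

theorem lintegral_quot_ne_top {s p : ℝ} (hp : 1 < p) {U : Set (E n)} {J : Set ℝ}
    {u u₀ : ℝ → E n → ℝ} (hu : MemLpW s p U J u) (h0 : ∀ t ∉ J, u₀ t = 0)
    (hae : ∀ᵐ t ∂(volume.restrict J), u₀ t =ᵐ[volume] u t) :
    ∫⁻ t, ∫⁻ z in U ×ˢ U, ‖quot s p (u₀ t) z‖ₑ ^ p ≠ ⊤ := by
  have hp0 : 0 < p := by linarith
  rw [lintegral_eq_setLIntegral_of_eq_zero (J := J) fun t ht => by
    simp [h0 t ht, quot_zero, hp0]]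
  refine ((lintegral_mono_ae ?_).trans_lt hu.2.2).ne
  filter_upwards [hae] with t ht
  rw [wNormPow_eq hp0]
  refine le_trans (le_of_eq ?_) le_add_self
  refine lintegral_congr_ae (ae_restrict_of_ae ?_)
  filter_upwards [quot_congr_ae s p ht] with z hz
  rw [hz]

theorem SolClass.of_memLp {s p : ℝ} (hp : 1 < p) {Ω' : Set (E n)} {J : Set ℝ}
    {u u₀ : ℝ → E n → ℝ} (hu : MemLpW s p Ω' J u) (hu' : MemLpTail s p J u)
    (hm : Measurable (Function.uncurry u₀)) (h0 : ∀ t ∉ J, u₀ t = 0)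
    (hae : ∀ᵐ t ∂(volume.restrict J), u₀ t =ᵐ[volume] u t) : SolClass s p Ω' u₀ := by
  refine ⟨hm, lintegral_quot_ne_top hp hu h0 hae, ?_⟩
  rw [lintegral_eq_setLIntegral_of_eq_zero (J := J) fun t ht => by simp [h0 t ht, hp]]
  refine (lt_of_eq_of_lt ?_ hu'.2.2).ne
  refine lintegral_congr_ae ?_
  filter_upwards [hae] with t ht
  refine lintegral_congr_ae ?_
  have hac : tailMeasure n (s * p) ≪ volume := withDensity_absolutelyContinuous _ _
  filter_upwards [hac.ae_le ht] with x hx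
  rw [hx]

/-- The potential energy `∫_Ω F(w(t))` of a Lipschitz function `F` is continuous along a curve
that is continuous in `L²(Ω)`. -/
theorem continuousOn_integral_comp {Ω : Set (E n)} (hb : Bornology.IsBounded Ω) {J : Set ℝ}
    {w : ℝ → E n → ℝ} {W : ℝ → L2 Ω} (hW : ContinuousOn W J) (hw : IsL2Curve Ω J w W)
    {F : ℝ → ℝ} {K : NNReal} (hF : LipschitzWith K F) (hF0 : F 0 = 0) :
    ContinuousOn (fun t => ∫ x in Ω, F (w t x)) J := by
  have : IsFiniteMeasure (volume.restrict Ω) := ⟨by simpa using hb.measure_lt_top⟩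
  have h1 : Continuous fun v : L2 Ω => ∫ x in Ω, (hF.compLp hF0 v) x := by
    have h2 : ∀ v : L2 Ω, ∫ x in Ω, v x =
        inner ℝ (indicatorConstLp 2 MeasurableSet.univ (measure_ne_top _ _) (1 : ℝ)) v := by
      intro v
      rw [L2.inner_indicatorConstLp_one, Measure.restrict_univ]
    simp_rw [h2]
    exact continuous_const.inner (hF.continuous_compLp hF0)
  refine (h1.comp_continuousOn hW).congr fun t ht => ?_
  refine integral_congr_ae ?_
  filter_upwards [hF.coeFn_compLp hF0 (W t), hw t ht] with x hx1 hx2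
  rw [hx1, Function.comp_apply, hx2]

theorem IsWeakSolution.exists_L2Curve_sub {s p : ℝ} [Fact (1 < p)] {Ω Ω' : Set (E n)}
    {f : ℝ → XZeroDual s p Ω Ω'} {u v : ℝ → E n → ℝ} (hu : IsWeakSolution s p Ω Ω' f u)
    (hv : IsWeakSolution s p Ω Ω' f v) {a b : ℝ} (ha : 0 < a) (hab : a < b) :
    ∃ W : ℝ → L2 Ω, IsL2Curve Ω (Icc a b) (fun t x => u t x - v t x) W ∧
      ContinuousOn W (Icc a b) := by
  obtain ⟨U, hU, hUc⟩ := hu.continuous_L2 a b ha hab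
  obtain ⟨V, hV, hVc⟩ := hv.continuous_L2 a b ha hab
  refine ⟨fun t => U t - V t, fun t ht => ?_, hUc.sub hVc⟩
  filter_upwards [hU t ht, hV t ht, Lp.coeFn_sub (U t) (V t)] with x h1 h2 h3
  rw [h3, Pi.sub_apply, h1, h2]

theorem enorm_quot_trunc_le (s p k M : ℝ) (w : E n → ℝ) (z : E n × E n) :
    ‖quot s p (fun x => trunc k M (w x)) z‖ₑ ≤ ‖quot s p w z‖ₑ := by
  rw [enorm_quot, enorm_quot]
  refine mul_le_mul_left ?_ _
  rw [← ofReal_norm, ← ofReal_norm]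
  exact ENNReal.ofReal_le_ofReal (abs_trunc_sub_le _ _ _ _)

/-- Pointwise coercivity of the difference of the fluxes against the truncated difference. -/
theorem coercive_flux {s p : ℝ} (hp : 2 ≤ p) (k M : ℝ) (u v : E n → ℝ) (z : E n × E n) :
    2 ^ (2 - p) * |quot s p (fun x => trunc k M (u x - v x)) z| ^ p ≤
      (Jp p (quot s p u z) - Jp p (quot s p v z)) *
        quot s p (fun x => trunc k M (u x - v x)) z := by
  have hr : 0 ≤ ‖z.1 - z.2‖ ^ ((n : ℝ) / p + s) := by positivity
  have hd : quot s p u z - quot s p v z =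
      ((u z.1 - v z.1) - (u z.2 - v z.2)) / ‖z.1 - z.2‖ ^ ((n : ℝ) / p + s) := by
    simp only [quot]
    ring
  refine coercive_Jp hp ?_ ?_
  · rw [hd, quot, abs_div, abs_div]
    exact div_le_div_of_nonneg_right (abs_trunc_sub_le _ _ _ _) (abs_nonneg _)
  · rw [hd, quot, div_mul_div_comm]
    exact div_nonneg (trunc_sub_mul_nonneg _ _ _ _) (mul_nonneg hr hr)

theorem lipschitzWith_truncPrim {M : ℝ} (hM : 0 ≤ M) (k : ℝ) :
    LipschitzWith M.toNNReal (truncPrim k M) := by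
  refine LipschitzWith.of_dist_le_mul fun r q => ?_
  rw [Real.dist_eq, Real.dist_eq, Real.coe_toNNReal _ hM]
  exact abs_truncPrim_sub_le hM k r q

theorem IsWeakSolution.integrable_truncPrim {s p : ℝ} [Fact (1 < p)] {Ω Ω' : Set (E n)}
    (hb : Bornology.IsBounded Ω) {f : ℝ → XZeroDual s p Ω Ω'} {u v : ℝ → E n → ℝ}
    (hu : IsWeakSolution s p Ω Ω' f u) (hv : IsWeakSolution s p Ω Ω' f v) (k : ℝ) {M : ℝ}
    (hM : 0 ≤ M) {t : ℝ} (ht : 0 < t) :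
    Integrable (fun x => truncPrim k M (u t x - v t x)) (volume.restrict Ω) := by
  have : IsFiniteMeasure (volume.restrict Ω) := ⟨by simpa using hb.measure_lt_top⟩
  have h1 : MemLp (fun x => u t x - v t x) 2 (volume.restrict Ω) :=
    (hu.memLp_two ht).sub (hv.memLp_two ht)
  have h2 := (lipschitzWith_truncPrim hM k).comp_memLp (truncPrim_zero k M) h1
  exact h2.integrable (by norm_num)

/-- The energy inequality for the truncations `φ` of the difference of two solutions. On each short
interval `[t, t + τ]` the equation is tested with `φ(t + τ)`, frozen in time. -/
theorem SolutionPair.energy {s p : ℝ} [Fact (1 < p)] (hs : 0 < s) (hp : 2 < p)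
    {Ω Ω' : Set (E n)} {f : ℝ → XZeroDual s p Ω Ω'} {u v : ℝ → E n → ℝ}
    (h : SolutionPair s p Ω Ω' f u v) {k M : ℝ} (hk : 0 ≤ k) (hM : 0 ≤ M) {a b : ℝ} (ha : 0 < a)
    (hab : a < b) :
    ENNReal.ofReal (∫ x in Ω, truncPrim k M (u b x - v b x)) +
        ENNReal.ofReal (2 ^ (2 - p)) * ∫⁻ t in Icc a b,
          ∫⁻ z, ‖quot s p (fun x => trunc k M (u t x - v t x)) z‖ₑ ^ p ≤
      ENNReal.ofReal (∫ x in Ω, truncPrim k M (u a x - v a x)) := by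
  have hp1 : 1 < p := by linarith
  have hp0 : 0 < p := by linarith
  have hab1 : a < b + 1 := by linarith
  obtain ⟨ho, hb, ho', hb', hsub, -, hu, hv, hw⟩ := h
  have hfin : IsFiniteMeasure (volume.restrict Ω) := ⟨by simpa using hb.measure_lt_top⟩
  set J := Icc a (b + 1) with hJ
  have hJm : MeasurableSet J := measurableSet_Icc
  obtain ⟨hwLp, hwW0⟩ := hw a (b + 1) ha hab1
  -- Borel representatives; `w₀` vanishes identically off `J × Ω`
  obtain ⟨u₀, hu₀m, hu₀J, -, hu₀⟩ := (hu.memLpW a (b + 1) ha hab1).1.exists_rep hJm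
    MeasurableSet.univ (Eventually.of_forall fun t => Eventually.of_forall fun x hx =>
      absurd (mem_univ x) hx)
  obtain ⟨w₀, hw₀m, hw₀J, hw₀Ω, hw₀⟩ := hwLp.1.exists_rep hJm ho.measurableSet
    (hwW0.mono fun t ht => ht.ae_eq_zero hp1 ho)
  set v₀ : ℝ → E n → ℝ := fun t x => u₀ t x - w₀ t x with hv₀def
  have hv₀m : Measurable (Function.uncurry v₀) := hu₀m.sub hw₀m
  have hv₀J : ∀ t ∉ J, v₀ t = 0 := by
    intro t ht
    ext x
    simp [hv₀def, hu₀J t ht, hw₀J t ht]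
  have hv₀ : ∀ᵐ t ∂(volume.restrict J), v₀ t =ᵐ[volume] v t := by
    filter_upwards [hu₀, hw₀] with t h1 h2
    filter_upwards [h1, h2] with x hx1 hx2
    simp [hv₀def, hx1, hx2]
  have hU : SolClass s p Ω' u₀ := SolClass.of_memLp hp1 (hu.memLpW a (b + 1) ha hab1)
    (hu.memLpTail a (b + 1) ha hab1) hu₀m hu₀J hu₀
  have hV : SolClass s p Ω' v₀ := SolClass.of_memLp hp1 (hv.memLpW a (b + 1) ha hab1)
    (hv.memLpTail a (b + 1) ha hab1) hv₀m hv₀J hv₀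
  set φ : ℝ → E n → ℝ := fun t x => trunc k M (w₀ t x) with hφdef
  have hφuv : ∀ t, φ t = fun x => trunc k M (u₀ t x - v₀ t x) := by
    intro t
    ext x
    simp [hφdef, hv₀def]
  have hw₀semi : ∫⁻ t, ∫⁻ z, ‖quot s p (w₀ t) z‖ₑ ^ p ≠ ⊤ := by
    have := lintegral_quot_ne_top hp1 hwLp hw₀J hw₀
    rwa [univ_prod_univ, Measure.restrict_univ] at this
  have hφm : Measurable (Function.uncurry φ) := (continuous_trunc k M).measurable.comp hw₀m
  have hφbd : ∀ t x, |φ t x| ≤ M := fun t x => by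
    rw [abs_of_nonneg (trunc_nonneg _ _ _)]
    exact trunc_le hM _ _
  have hφΩ : ∀ t, ∀ x ∉ Ω, φ t x = 0 := fun t x hx => by
    simp only [hφdef, hw₀Ω t x hx]
    exact trunc_of_le M hk
  have hφsemi : ∀ t, ∫⁻ z, ‖quot s p (φ t) z‖ₑ ^ p ≤ ∫⁻ z, ‖quot s p (w₀ t) z‖ₑ ^ p := fun t =>
    lintegral_mono fun z => ENNReal.rpow_le_rpow (enorm_quot_trunc_le s p k M (w₀ t) z) hp0.le
  have hφ : TestClass s p M Ω φ :=
    ⟨hφm, hφbd, hφΩ, ((lintegral_mono hφsemi).trans_lt hw₀semi.lt_top).ne⟩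
  have hQ := measurable_quot s p hφm
  have hDu := measurable_quot s p hu₀m
  have hDv := measurable_quot s p hv₀m
  have hJp := measurable_Jp p
  -- almost every time slice of `φ` is an admissible test function
  have hgood : ∀ᵐ t, t ∈ J → w₀ t =ᵐ[volume] (fun x => u t x - v t x) ∧
      SpaceTest s p M Ω (φ t) := by
    have h1 : ∀ᵐ t, ∫⁻ z, ‖quot s p (φ t) z‖ₑ ^ p < ⊤ :=
      ae_lt_top ((hQ.enorm.pow_const p).lintegral_prod_right') hφ.seminorm
    filter_upwards [(ae_restrict_iff' hJm).1 hw₀, h1] with t h2 h3 htJ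
    exact ⟨h2 htJ, hφm.comp measurable_prodMk_left, hφbd t, hφΩ t, h3.ne⟩
  -- the error made by freezing the test function in time
  set P : ℝ × (E n × E n) → ℝ≥0∞ := fun q =>
    ‖Jp p (quot s p (u₀ q.1) q.2)‖ₑ + ‖Jp p (quot s p (v₀ q.1) q.2)‖ₑ with hP
  have hPm : Measurable P := by
    have h1 : Measurable fun q : ℝ × (E n × E n) => Jp p (quot s p (u₀ q.1) q.2) := hJp.comp hDu
    have h2 : Measurable fun q : ℝ × (E n × E n) => Jp p (quot s p (v₀ q.1) q.2) := hJp.comp hDv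
    exact h1.enorm.add h2.enorm
  set R : ℝ → ℝ → ℝ≥0∞ := fun τ δ =>
    ∫⁻ z, P (τ, z) * ‖quot s p (φ (τ + δ)) z - quot s p (φ τ) z‖ₑ with hR
  have hRm0 : Measurable fun y : (ℝ × ℝ) × (E n × E n) =>
      P (y.1.1, y.2) * ‖quot s p (φ (y.1.1 + y.1.2)) y.2 - quot s p (φ y.1.1) y.2‖ₑ := by
    have h1 : Measurable fun y : (ℝ × ℝ) × (E n × E n) =>
        quot s p (φ (y.1.1 + y.1.2)) y.2 :=
      hQ.comp (f := fun y : (ℝ × ℝ) × (E n × E n) => (y.1.1 + y.1.2, y.2)) (by fun_prop)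
    have h2 : Measurable fun y : (ℝ × ℝ) × (E n × E n) => quot s p (φ y.1.1) y.2 :=
      hQ.comp (f := fun y : (ℝ × ℝ) × (E n × E n) => (y.1.1, y.2)) (by fun_prop)
    have h3 : Measurable fun y : (ℝ × ℝ) × (E n × E n) => P (y.1.1, y.2) :=
      hPm.comp (by fun_prop)
    exact h3.mul (h1.sub h2).enorm
  have hRm : Measurable (Function.uncurry R) := hRm0.lintegral_prod_right'
  have hRlim : Tendsto (fun δ => ∫⁻ τ, R τ δ) (𝓝 0) (𝓝 0) := by
    have h1 := (hU.tendsto_flux_translate hs hp ho hb ho' hsub hφ).add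
      (hV.tendsto_flux_translate hs hp ho hb ho' hsub hφ)
    rw [add_zero] at h1
    refine h1.congr fun δ => ?_
    have h2 : Measurable fun q : ℝ × (E n × E n) =>
        quot s p (φ (q.1 + δ)) q.2 - quot s p (φ q.1) q.2 :=
      (hQ.comp (f := fun q : ℝ × (E n × E n) => (q.1 + δ, q.2)) (by fun_prop)).sub hQ
    have h3 : Measurable fun q : ℝ × (E n × E n) => Jp p (quot s p (u₀ q.1) q.2) := hJp.comp hDu
    have h4 : Measurable fun q : ℝ × (E n × E n) => ‖Jp p (quot s p (u₀ q.1) q.2)‖ₑ *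
        ‖quot s p (φ (q.1 + δ)) q.2 - quot s p (φ q.1) q.2‖ₑ := h3.enorm.mul h2.enorm
    have h5 : Measurable fun q : ℝ × (E n × E n) => P q *
        ‖quot s p (φ (q.1 + δ)) q.2 - quot s p (φ q.1) q.2‖ₑ := hPm.mul h2.enorm
    rw [← lintegral_add_left h4]
    simp_rw [← add_mul]
    exact lintegral_time_space h5
  set c : ℝ≥0∞ := ENNReal.ofReal (2 ^ (2 - p)) with hc
  set N : ℝ → ℝ≥0∞ := fun t => c * ∫⁻ z, ‖quot s p (φ t) z‖ₑ ^ p with hN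
  have hNm : Measurable N := ((hQ.enorm.pow_const p).lintegral_prod_right').const_mul c
  set En : ℝ → ℝ := fun t => ∫ x in Ω, truncPrim k M (u t x - v t x) with hEn
  have hEn0 : ∀ t, 0 ≤ En t := fun t => integral_nonneg fun x => truncPrim_nonneg hk _ _
  obtain ⟨W, hWc, hWcont⟩ := hu.exists_L2Curve_sub hv ha hab1
  have hEcont : ContinuousOn En J := continuousOn_integral_comp hb hWcont hWc
    (lipschitzWith_truncPrim hM k) (truncPrim_zero k M)
  have hFint : ∀ t, 0 < t → Integrable (fun x => truncPrim k M (u t x - v t x))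
      (volume.restrict Ω) := fun t ht => hu.integrable_truncPrim hb hv k hM ht
  have key := energy_le_of_increments hab hEn0 hEcont hNm hRm hRlim ?_
  · refine le_trans (le_of_eq ?_) key
    congr 1
    rw [hN, lintegral_const_mul' _ _ ENNReal.ofReal_ne_top]
    congr 1
    refine lintegral_congr_ae ?_
    filter_upwards [ae_restrict_of_ae_restrict_of_subset
      (Icc_subset_Icc_right (by linarith : b ≤ b + 1)) hw₀] with t ht
    refine lintegral_congr_ae ?_
    have h1 : φ t =ᵐ[volume] fun x => trunc k M (u t x - v t x) := by
      filter_upwards [ht] with x hx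
      simp only [hφdef, hx]
    filter_upwards [quot_congr_ae s p h1] with z hz
    rw [hz]
  · intro τ hτ0 hτ1
    have hshift : ∀ᵐ t, t + τ ∈ J → w₀ (t + τ) =ᵐ[volume]
        (fun x => u (t + τ) x - v (t + τ) x) ∧ SpaceTest s p M Ω (φ (t + τ)) :=
      (measurePreserving_add_right volume τ).quasiMeasurePreserving.ae hgood
    filter_upwards [ae_restrict_mem measurableSet_Icc, ae_restrict_of_ae hshift] with t ht hst
    have htτ : t + τ ∈ J := ⟨by linarith [ht.1], by linarith [ht.2]⟩
    obtain ⟨hweq, hψ⟩ := hst htτ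
    have ht0 : 0 < t := by linarith [ht.1]
    have hsubJ : Icc t (t + τ) ⊆ J := Icc_subset_Icc ht.1 htτ.2
    have heq := hu.flux_sub_eq hv hU hV hs hp ho hb ho' hb' hsub hψ ht0
      (by linarith : t < t + τ) (ae_restrict_of_ae_restrict_of_subset hsubJ hu₀)
      (ae_restrict_of_ae_restrict_of_subset hsubJ hv₀)
    have hi := (hU.integrableOn_flux_mul hs hp ho hb ho' hsub hψ t (t + τ)).sub
      (hV.integrableOn_flux_mul hs hp ho hb ho' hsub hψ t (t + τ))
    have hi' : Integrable (fun q : ℝ × (E n × E n) =>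
        (Jp p (quot s p (u₀ q.1) q.2) - Jp p (quot s p (v₀ q.1) q.2)) *
          quot s p (φ (t + τ)) q.2) ((volume.restrict (Icc t (t + τ))).prod volume) :=
      hi.congr (Eventually.of_forall fun q => by simp only [Pi.sub_apply]; ring)
    -- convexity of the primitive
    have hconv : En (t + τ) - En t ≤ -∫ q,
        (Jp p (quot s p (u₀ q.1) q.2) - Jp p (quot s p (v₀ q.1) q.2)) *
          quot s p (φ (t + τ)) q.2 ∂((volume.restrict (Icc t (t + τ))).prod volume) := by
      rw [heq, hEn, ← integral_sub (hFint _ (by linarith)) (hFint _ ht0), ← integral_neg]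
      have h1 : MemLp (fun x => (u t x - v t x) - (u (t + τ) x - v (t + τ) x)) 2
          (volume.restrict Ω) :=
        ((hu.memLp_two ht0).sub (hv.memLp_two ht0)).sub
          ((hu.memLp_two (by linarith)).sub (hv.memLp_two (by linarith)))
      refine integral_mono_ae ((hFint _ (by linarith)).sub (hFint _ ht0))
        ((hψ.memLp 2 _).integrable_mul h1).neg ?_
      filter_upwards [ae_restrict_of_ae hweq] with x hx
      have h2 := truncPrim_sub_le k M (u (t + τ) x - v (t + τ) x) (u t x - v t x)
      have h3 : φ (t + τ) x = trunc k M (u (t + τ) x - v (t + τ) x) := by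
        simp only [hφdef, hx]
      rw [h3]
      linarith
    have hg : Measurable fun q : ℝ × (E n × E n) => c * ‖quot s p (φ q.1) q.2‖ₑ ^ p :=
      (hQ.enorm.pow_const p).const_mul c
    have hNN : Measurable fun q : ℝ × (E n × E n) =>
        P q * ‖quot s p (φ (q.1 + (t + τ - q.1))) q.2 - quot s p (φ q.1) q.2‖ₑ :=
      hRm0.comp (f := fun q : ℝ × (E n × E n) => ((q.1, t + τ - q.1), q.2)) (by fun_prop)
    have hmain := ofReal_add_lintegral_le hi' hg.aemeasurable (N := fun q =>
      P q * ‖quot s p (φ (q.1 + (t + τ - q.1))) q.2 - quot s p (φ q.1) q.2‖ₑ) ?_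
      (hEn0 t) (hEn0 (t + τ)) hconv
    · rw [lintegral_prod _ hg.aemeasurable, lintegral_prod _ hNN.aemeasurable] at hmain
      have h1 : ∀ τ, N τ = ∫⁻ z, c * ‖quot s p (φ τ) z‖ₑ ^ p := fun τ =>
        (lintegral_const_mul' c _ ENNReal.ofReal_ne_top).symm
      simp_rw [h1]
      exact hmain
    · rintro ⟨σ, z⟩
      have hcoer := coercive_flux (s := s) hp.le k M (u₀ σ) (v₀ σ) z
      rw [← hφuv] at hcoer
      set B := Jp p (quot s p (u₀ σ) z) - Jp p (quot s p (v₀ σ) z) with hB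
      set d₀ := quot s p (φ σ) z with hd₀
      have hd₁ : φ (σ + (t + τ - σ)) = φ (t + τ) := by
        congr 1
        ring
      dsimp only
      rw [hd₁]
      set d₁ := quot s p (φ (t + τ)) z with hd₁
      have hBP : ENNReal.ofReal (|B| * |d₁ - d₀|) ≤ P (σ, z) * ‖d₁ - d₀‖ₑ := by
        rw [ENNReal.ofReal_mul (abs_nonneg _), ← Real.norm_eq_abs, ← Real.norm_eq_abs,
          ofReal_norm, ofReal_norm]
        gcongr
        exact enorm_sub_le
      have h1 : c * ‖d₀‖ₑ ^ p = ENNReal.ofReal (2 ^ (2 - p) * |d₀| ^ p) := by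
        rw [hc, ENNReal.ofReal_mul (by positivity), ← ofReal_norm, Real.norm_eq_abs,
          ENNReal.ofReal_rpow_of_nonneg (abs_nonneg _) hp0.le]
      refine le_trans ?_ (add_le_add_right hBP _)
      rw [h1]
      have h2 : 2 ^ (2 - p) * |d₀| ^ p ≤ B * d₁ + |B| * |d₁ - d₀| := by
        have h3 : B * d₀ = B * d₁ - B * (d₁ - d₀) := by ring
        have h4 : -(B * (d₁ - d₀)) ≤ |B| * |d₁ - d₀| := by
          rw [← abs_mul]
          exact neg_le_abs _
        linarith
      have h5 : (0 : ℝ) ≤ 2 ^ (2 - p) * |d₀| ^ p := by positivity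
      rcases le_total 0 (B * d₁) with h6 | h6
      · rw [ENNReal.ofReal_of_nonpos (p := -(B * d₁)) (by linarith), add_zero,
          ← ENNReal.ofReal_add h6 (by positivity)]
        exact ENNReal.ofReal_le_ofReal h2
      · rw [ENNReal.ofReal_of_nonpos h6, zero_add, ← ENNReal.ofReal_add h5 (by linarith)]
        exact ENNReal.ofReal_le_ofReal (by linarith)

/-! ### The Caccioppoli inequality and one step of the iteration -/

/-- Joint measurability of the quotients of an almost everywhere measurable family. -/
theorem aemeasurable_quot_time (s p : ℝ) {μ : Measure ℝ} [SFinite μ] {g : ℝ × E n → ℝ}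
    (hg : AEMeasurable g (μ.prod volume)) :
    AEMeasurable (fun q : ℝ × (E n × E n) => quot s p (fun x => g (q.1, x)) q.2)
      (μ.prod volume) := by
  have h1 : AEMeasurable (fun q : ℝ × (E n × E n) => g (q.1, q.2.1)) (μ.prod volume) :=
    hg.comp_quasiMeasurePreserving (f := Prod.map id Prod.fst)
      (MeasureTheory.QuasiMeasurePreserving.prodMap (Measure.QuasiMeasurePreserving.id _)
        Measure.quasiMeasurePreserving_fst)
  have h2 : AEMeasurable (fun q : ℝ × (E n × E n) => g (q.1, q.2.2)) (μ.prod volume) :=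
    hg.comp_quasiMeasurePreserving (f := Prod.map id Prod.snd)
      (MeasureTheory.QuasiMeasurePreserving.prodMap (Measure.QuasiMeasurePreserving.id _)
        Measure.quasiMeasurePreserving_snd)
  unfold quot
  exact (h1.sub h2).div (by fun_prop)

/-- Lebesgue measure on the cylinder `[a, b] × Ω`. -/
def cylMeasure (a b : ℝ) (Ω : Set (E n)) : Measure (ℝ × E n) :=
  (volume.restrict (Icc a b)).prod (volume.restrict Ω)

/-- The excess `∫_a^b ∫_Ω (w - k)₊^p dx dt` over the level `k`. -/
def excess (p : ℝ) (Ω : Set (E n)) (w : ℝ → E n → ℝ) (a b k : ℝ) : ℝ≥0∞ :=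
  ∫⁻ q, ENNReal.ofReal (max 0 (w q.1 q.2 - k)) ^ p ∂(cylMeasure a b Ω)

theorem excess_mono {p : ℝ} (hp : 0 ≤ p) (Ω : Set (E n)) (w : ℝ → E n → ℝ) {a a' b k k' : ℝ}
    (ha : a ≤ a') (hk : k ≤ k') : excess p Ω w a' b k' ≤ excess p Ω w a b k := by
  refine lintegral_mono' (Measure.prod_mono
    (Measure.restrict_mono (Icc_subset_Icc_left ha) le_rfl) le_rfl) fun q => ?_
  gcongr

section

variable {s p : ℝ} [Fact (1 < p)] {Ω Ω' : Set (E n)} {f : ℝ → XZeroDual s p Ω Ω'}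
  {u v : ℝ → E n → ℝ}

theorem SolutionPair.aemeasurable (h : SolutionPair s p Ω Ω' f u v) {a b : ℝ} (ha : 0 < a)
    (hab : a < b) :
    AEMeasurable (fun q : ℝ × E n => u q.1 q.2 - v q.1 q.2) (cylMeasure a b Ω) := by
  have h1 := (h.memW0 a b ha hab).1.1.aemeasurable
  exact h1.mono_measure (Measure.prod_mono le_rfl Measure.restrict_le_self)

/-- The Caccioppoli inequality: the energy above the level `m` is controlled by the excess over a
lower level `k` on a larger time interval. -/
theorem SolutionPair.caccioppoli (h : SolutionPair s p Ω Ω' f u v) (hs : 0 < s) (hp : 2 < p)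
    {k m M : ℝ} (hk : 0 ≤ k) (hkm : k < m) (hM : 0 ≤ M) {τ₁ τ₂ t t₂ : ℝ} (hτ₁ : 0 < τ₁)
    (hτ : τ₁ < τ₂) (ht : τ₂ ≤ t) (htt : t ≤ t₂) :
    (∫⁻ x in Ω, ENNReal.ofReal (truncPrim m M (u t x - v t x))) +
        ENNReal.ofReal (2 ^ (2 - p)) * ∫⁻ τ in Icc τ₂ t,
          ∫⁻ z, ‖quot s p (fun x => trunc m M (u τ x - v τ x)) z‖ₑ ^ p ≤
      ENNReal.ofReal (((m - k) ^ (p - 2) * (τ₂ - τ₁))⁻¹) *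
        excess p Ω (fun t x => u t x - v t x) τ₁ t₂ k := by
  have hm0 : 0 ≤ m := hk.trans hkm.le
  have hmk : 0 < m - k := sub_pos.2 hkm
  have hτ0 : 0 < τ₂ - τ₁ := sub_pos.2 hτ
  have hmkp : 0 < (m - k) ^ (p - 2) := Real.rpow_pos_of_pos hmk _
  have hE : ∀ σ, 0 < σ → ENNReal.ofReal (∫ x in Ω, truncPrim m M (u σ x - v σ x)) =
      ∫⁻ x in Ω, ENNReal.ofReal (truncPrim m M (u σ x - v σ x)) := fun σ hσ =>
    ofReal_integral_eq_lintegral_ofReal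
      (h.solution_u.integrable_truncPrim h.isBounded h.solution_v m hM hσ)
      (Eventually.of_forall fun x => truncPrim_nonneg hm0 _ _)
  set A := (∫⁻ x in Ω, ENNReal.ofReal (truncPrim m M (u t x - v t x))) +
        ENNReal.ofReal (2 ^ (2 - p)) * ∫⁻ τ in Icc τ₂ t,
          ∫⁻ z, ‖quot s p (fun x => trunc m M (u τ x - v τ x)) z‖ₑ ^ p with hA
  have hstep : ∀ σ ∈ Ioo τ₁ τ₂, A ≤
      ∫⁻ x in Ω, ENNReal.ofReal (truncPrim m M (u σ x - v σ x)) := by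
    intro σ hσ
    have h1 := h.energy hs hp hm0 hM (hτ₁.trans hσ.1) (hσ.2.trans_le ht)
    rw [hE _ (by linarith), hE _ (hτ₁.trans hσ.1)] at h1
    refine le_trans ?_ h1
    rw [hA]
    gcongr
    exact hσ.2.le
  have hpt : ∀ r : ℝ, ENNReal.ofReal (truncPrim m M r) ≤
      ENNReal.ofReal (((m - k) ^ (p - 2))⁻¹) * ENNReal.ofReal (max 0 (r - k)) ^ p := by
    intro r
    rw [ENNReal.ofReal_rpow_of_nonneg (le_max_left _ _) (by linarith),
      ← ENNReal.ofReal_mul (by positivity)]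
    refine ENNReal.ofReal_le_ofReal ((truncPrim_le m M r).trans ?_)
    rcases le_total r m with hr | hr
    · rw [max_eq_left (sub_nonpos.2 hr)]
      have : 0 ≤ max 0 (r - k) := le_max_left _ _
      rw [zero_pow two_ne_zero]
      positivity
    · rw [max_eq_right (sub_nonneg.2 hr), max_eq_right (by linarith : 0 ≤ r - k),
        inv_mul_eq_div, le_div_iff₀ hmkp]
      have h1 : (r - k) ^ p = (r - k) ^ 2 * (r - k) ^ (p - 2) := by
        rw [← Real.rpow_natCast, ← Real.rpow_add (by linarith)]
        congr 1
        push_cast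
        ring
      rw [h1]
      gcongr
  have h1 : ENNReal.ofReal (τ₂ - τ₁) * A ≤
      ENNReal.ofReal (((m - k) ^ (p - 2))⁻¹) *
        excess p Ω (fun t x => u t x - v t x) τ₁ t₂ k := by
    calc ENNReal.ofReal (τ₂ - τ₁) * A = ∫⁻ _ in Ioo τ₁ τ₂, A := by
          rw [setLIntegral_const, Real.volume_Ioo, mul_comm]
      _ ≤ ∫⁻ σ in Ioo τ₁ τ₂, ∫⁻ x in Ω, ENNReal.ofReal (((m - k) ^ (p - 2))⁻¹) *
            ENNReal.ofReal (max 0 (u σ x - v σ x - k)) ^ p :=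
          setLIntegral_mono' measurableSet_Ioo fun σ hσ =>
            (hstep σ hσ).trans (lintegral_mono fun x => hpt _)
      _ ≤ ∫⁻ σ in Icc τ₁ t₂, ∫⁻ x in Ω, ENNReal.ofReal (((m - k) ^ (p - 2))⁻¹) *
            ENNReal.ofReal (max 0 (u σ x - v σ x - k)) ^ p :=
          lintegral_mono_set (Ioo_subset_Icc_self.trans (Icc_subset_Icc_right (ht.trans htt)))
      _ = _ := by
          simp_rw [lintegral_const_mul' _ _ (ENNReal.ofReal_ne_top (r := ((m - k) ^ (p - 2))⁻¹))]
          rw [excess, cylMeasure, lintegral_prod]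
          have h2 := h.aemeasurable hτ₁ (hτ.trans_le (ht.trans htt))
          exact ((aemeasurable_const.max (h2.sub_const k)).ennreal_ofReal).pow_const p
  have h2 : A = ENNReal.ofReal (τ₂ - τ₁)⁻¹ * (ENNReal.ofReal (τ₂ - τ₁) * A) := by
    rw [← mul_assoc, ← ENNReal.ofReal_mul (by positivity), inv_mul_cancel₀ hτ0.ne',
      ENNReal.ofReal_one, one_mul]
  rw [h2, mul_inv, mul_comm _ (τ₂ - τ₁)⁻¹, ENNReal.ofReal_mul (by positivity), mul_assoc]
  gcongr

/-- Removal of the upper cutoff in a bound for truncations. -/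
theorem lintegral_max_le_of_trunc {μ : Measure (ℝ × E n)} {p : ℝ}
    {w : ℝ × E n → ℝ} (hw : AEMeasurable w μ) {k M₀ : ℝ} {B : ℝ≥0∞}
    (h : ∀ M, M₀ ≤ M → ∫⁻ q, ENNReal.ofReal (trunc k M (w q)) ^ p ∂μ ≤ B) :
    ∫⁻ q, ENNReal.ofReal (max 0 (w q - k)) ^ p ∂μ ≤ B := by
  set F : ℕ → ℝ × E n → ℝ≥0∞ := fun i q => ENNReal.ofReal (trunc k (M₀ + i) (w q)) ^ p with hF
  have hlim : ∀ q, liminf (fun i => F i q) atTop = ENNReal.ofReal (max 0 (w q - k)) ^ p := by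
    intro q
    refine (tendsto_const_nhds.congr' ?_).liminf_eq
    obtain ⟨j, hj⟩ := exists_nat_ge (w q - k - M₀)
    filter_upwards [eventually_ge_atTop j] with i hi
    have : (j : ℝ) ≤ i := by exact_mod_cast hi
    rw [hF]
    dsimp only
    rw [trunc, min_eq_left (by linarith)]
  simp_rw [← hlim]
  refine (lintegral_liminf_le' fun i => ?_).trans ?_
  · exact ((continuous_trunc _ _).measurable.comp_aemeasurable hw).ennreal_ofReal.pow_const _
  · refine liminf_le_of_le (by isBoundedDefault) fun b hb => ?_
    obtain ⟨i, hi⟩ := hb.exists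
    exact hi.trans (h _ (by linarith [(Nat.cast_nonneg i : (0 : ℝ) ≤ i)]))

/-- One step of the De Giorgi iteration, for a domain on which a Faber-Krahn inequality with
exponent `ν` holds. -/
theorem SolutionPair.excess_step (h : SolutionPair s p Ω Ω' f u v) (hs : 0 < s) (hp : 2 < p)
    {K ν : ℝ} (hK : 0 < K) (hν : 0 < ν)
    (hFK : ∀ g : E n → ℝ, AEMeasurable g → (∀ᵐ x, x ∉ Ω → g x = 0) →
      ∫⁻ x, ‖g x‖ₑ ^ p ≤
        ENNReal.ofReal K * volume {x | g x ≠ 0} ^ ν * ∫⁻ z, ‖quot s p g z‖ₑ ^ p)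
    {k d : ℝ} (hk : 0 ≤ k) (hd : 0 < d) {τ₁ τ₂ t₂ : ℝ} (hτ₁ : 0 < τ₁) (hτ : τ₁ < τ₂)
    (ht : τ₂ ≤ t₂) :
    excess p Ω (fun t x => u t x - v t x) τ₂ t₂ (k + 2 * d) ≤
      ENNReal.ofReal (K * 2 ^ (p - 2) * (4 / d ^ 2) ^ ν *
          ((d ^ (p - 2) * (τ₂ - τ₁))⁻¹) ^ (1 + ν)) *
        excess p Ω (fun t x => u t x - v t x) τ₁ t₂ k ^ (1 + ν) := by
  have hp1 : 1 < p := by linarith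
  have hp0 : 0 < p := by linarith
  set w : ℝ → E n → ℝ := fun t x => u t x - v t x with hw
  have hτ0 : 0 < τ₂ - τ₁ := sub_pos.2 hτ
  set Y := excess p Ω w τ₁ t₂ k with hY
  set a : ℝ := (d ^ (p - 2) * (τ₂ - τ₁))⁻¹ with ha
  have ha0 : 0 < a := by positivity
  set X := ENNReal.ofReal a * Y with hX
  have hτ₁t : τ₁ < t₂ := hτ.trans_le ht
  have hwm := h.aemeasurable hτ₁ hτ₁t
  have hwm2 : AEMeasurable (fun q : ℝ × E n => w q.1 q.2) (cylMeasure τ₂ t₂ Ω) :=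
    hwm.mono_measure (Measure.prod_mono
      (Measure.restrict_mono (Icc_subset_Icc_left hτ.le) le_rfl) le_rfl)
  obtain ⟨hwLp, hwW0⟩ := h.memW0 τ₁ t₂ hτ₁ hτ₁t
  refine lintegral_max_le_of_trunc hwm2 (M₀ := d) fun M hM => ?_
  have hM0 : 0 ≤ M := hd.le.trans hM
  -- measure of the superlevel sets, from the energy above the intermediate level `k + d`
  have hlevel : ∀ t ∈ Icc τ₂ t₂, volume ({x | k + 2 * d < w t x} ∩ Ω) ≤
      ENNReal.ofReal (4 / d ^ 2) * X := by
    intro t htt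
    have ht0 : 0 < t := by linarith [htt.1]
    have h1 := h.caccioppoli hs hp hk (by linarith : k < k + d) hM0 hτ₁ hτ htt.1 htt.2
    rw [add_sub_cancel_left, ← ha, ← hY, ← hX] at h1
    have h2 := le_self_add.trans h1
    have h3 := mul_meas_ge_le_lintegral₀
      (h.solution_u.integrable_truncPrim h.isBounded h.solution_v (k + d) hM0
        ht0).1.aemeasurable.ennreal_ofReal (ENNReal.ofReal (d ^ 2 / 4))
    have h4 : volume ({x | k + 2 * d < w t x} ∩ Ω) ≤ volume.restrict Ω
        {x | ENNReal.ofReal (d ^ 2 / 4) ≤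
          ENNReal.ofReal (truncPrim (k + d) M (u t x - v t x))} := by
      rw [← Measure.restrict_apply' h.isOpen.measurableSet]
      refine measure_mono fun x hx => ENNReal.ofReal_le_ofReal ?_
      have h5 := le_truncPrim (k := k + d) (k' := k + 2 * d) (M := M) (by linarith)
        (by linarith) (by linarith) (le_of_lt hx)
      have h6 : k + 2 * d - (k + d) = d := by ring
      rwa [h6] at h5
    have h7 : ENNReal.ofReal (4 / d ^ 2) * ENNReal.ofReal (d ^ 2 / 4) = 1 := by
      rw [← ENNReal.ofReal_mul (by positivity), ← ENNReal.ofReal_one]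
      congr 1
      field_simp
    calc volume ({x | k + 2 * d < w t x} ∩ Ω)
        = ENNReal.ofReal (4 / d ^ 2) * (ENNReal.ofReal (d ^ 2 / 4) *
            volume ({x | k + 2 * d < w t x} ∩ Ω)) := by rw [← mul_assoc, h7, one_mul]
      _ ≤ ENNReal.ofReal (4 / d ^ 2) * X := by
          gcongr
          exact (mul_le_mul_right h4 _).trans (h3.trans h2)
  -- dissipation above the level `k + 2 * d`
  have hdiss : ∫⁻ t in Icc τ₂ t₂, ∫⁻ z, ‖quot s p (fun x => trunc (k + 2 * d) M (w t x)) z‖ₑ ^ p ≤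
      ENNReal.ofReal (2 ^ (p - 2)) * X := by
    have h1 := h.caccioppoli hs hp hk (by linarith : k < k + 2 * d) hM0 hτ₁ hτ ht le_rfl
    rw [add_sub_cancel_left] at h1
    have h2 := le_add_self.trans h1
    have h3 : ENNReal.ofReal (((2 * d) ^ (p - 2) * (τ₂ - τ₁))⁻¹) * Y ≤ X := by
      rw [hX, ha]
      gcongr
      linarith
    have h4 : ENNReal.ofReal (2 ^ (p - 2)) * ENNReal.ofReal (2 ^ (2 - p)) = 1 := by
      rw [← ENNReal.ofReal_mul (by positivity), ← Real.rpow_add two_pos,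
        show p - 2 + (2 - p) = 0 by ring, Real.rpow_zero, ENNReal.ofReal_one]
    rw [← one_mul (∫⁻ t in Icc τ₂ t₂, _), ← h4, mul_assoc]
    gcongr
    exact h2.trans h3
  have hcm : AEMeasurable (fun q : ℝ × E n => ENNReal.ofReal (trunc (k + 2 * d) M (w q.1 q.2)) ^ p)
      (cylMeasure τ₂ t₂ Ω) :=
    ((continuous_trunc _ _).measurable.comp_aemeasurable hwm2).ennreal_ofReal.pow_const _
  calc ∫⁻ q, ENNReal.ofReal (trunc (k + 2 * d) M (w q.1 q.2)) ^ p ∂(cylMeasure τ₂ t₂ Ω)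
      = ∫⁻ t in Icc τ₂ t₂, ∫⁻ x in Ω, ENNReal.ofReal (trunc (k + 2 * d) M (w t x)) ^ p :=
        lintegral_prod _ hcm
    _ ≤ ∫⁻ t in Icc τ₂ t₂, ENNReal.ofReal K * (ENNReal.ofReal (4 / d ^ 2) * X) ^ ν *
          ∫⁻ z, ‖quot s p (fun x => trunc (k + 2 * d) M (w t x)) z‖ₑ ^ p := by
        have h1 : ∀ᵐ t ∂(volume.restrict (Icc τ₂ t₂)), MemW0 s p Ω (w t) :=
          ae_restrict_of_ae_restrict_of_subset (Icc_subset_Icc_left hτ.le) hwW0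
        refine lintegral_mono_ae ?_
        filter_upwards [h1, ae_restrict_mem measurableSet_Icc] with t hwt htt
        have h2 : AEMeasurable (w t) := by
          have := hwt.1.1.1.aemeasurable
          rwa [Measure.restrict_univ] at this
        have h3 := hwt.ae_eq_zero hp1 h.isOpen
        have h0 : ∀ x, w t x = 0 → trunc (k + 2 * d) M (w t x) = 0 := fun x hx => by
          rw [hx]
          exact trunc_of_le M (by linarith)
        have h4 := hFK (fun x => trunc (k + 2 * d) M (w t x))
          ((continuous_trunc _ _).measurable.comp_aemeasurable h2)
          (h3.mono fun x hx hxΩ => h0 x (hx hxΩ))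
        have h5 : volume {x | trunc (k + 2 * d) M (w t x) ≠ 0} ≤
            volume ({x | k + 2 * d < w t x} ∩ Ω) := by
          refine measure_mono_ae ?_
          filter_upwards [h3] with x hx hx'
          refine ⟨?_, ?_⟩
          · by_contra h6
            exact hx' (trunc_of_le M (not_lt.1 h6))
          · by_contra h6
            exact hx' (h0 x (hx h6))
        calc ∫⁻ x in Ω, ENNReal.ofReal (trunc (k + 2 * d) M (w t x)) ^ p
            ≤ ∫⁻ x, ‖trunc (k + 2 * d) M (w t x)‖ₑ ^ p := by
              refine (setLIntegral_le_lintegral _ _).trans (lintegral_mono fun x => ?_)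
              rw [Real.enorm_of_nonneg (trunc_nonneg _ _ _)]
          _ ≤ _ := h4
          _ ≤ _ := by
              gcongr
              exact h5.trans (hlevel t htt)
    _ ≤ ENNReal.ofReal K * (ENNReal.ofReal (4 / d ^ 2) * X) ^ ν *
          (ENNReal.ofReal (2 ^ (p - 2)) * X) := by
        refine le_trans (le_of_eq ?_) (mul_le_mul_right hdiss _)
        refine lintegral_const_mul'' _ ?_
        have h2 := aemeasurable_quot_time s p
          ((continuous_trunc (k + 2 * d) M).measurable.comp_aemeasurable
            (hwLp.1.aemeasurable.mono_measure (Measure.prod_mono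
              (Measure.restrict_mono (Icc_subset_Icc_left hτ.le) le_rfl) le_rfl)))
        exact (h2.enorm.pow_const p).lintegral_prod_right'
    _ = _ := by
        have h1 : (ENNReal.ofReal (4 / d ^ 2) * X) ^ ν =
            ENNReal.ofReal ((4 / d ^ 2) ^ ν) * X ^ ν := by
          rw [ENNReal.mul_rpow_of_nonneg _ _ hν.le,
            ENNReal.ofReal_rpow_of_nonneg (by positivity) hν.le]
        have h2 : X * X ^ ν = ENNReal.ofReal (a ^ (1 + ν)) * Y ^ (1 + ν) := by
          have h3 := ENNReal.rpow_add_of_nonneg (x := X) 1 ν zero_le_one hν.le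
          rw [ENNReal.rpow_one] at h3
          rw [← h3, hX, ENNReal.mul_rpow_of_nonneg _ _ (by linarith),
            ENNReal.ofReal_rpow_of_nonneg ha0.le (by linarith)]
        rw [h1]
        calc _ = ENNReal.ofReal K * ENNReal.ofReal (2 ^ (p - 2)) *
              ENNReal.ofReal ((4 / d ^ 2) ^ ν) * (X * X ^ ν) := by ring
          _ = _ := by
              rw [h2, ← mul_assoc, ← ENNReal.ofReal_mul hK.le, ← ENNReal.ofReal_mul (by positivity),
                ← ENNReal.ofReal_mul (by positivity)]

end

/-- A superlinear recursion with geometrically growing coefficients converges to zero from small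
initial data: by induction, `Y j` decays at least like the powers of `b ^ (-(1 / ν))`. -/
theorem tendsto_zero_of_superlinear {Y : ℕ → ℝ≥0∞} {A b ν : ℝ} (hA : 0 ≤ A) (hb : 1 < b)
    (hν : 0 < ν) (h0 : Y 0 ≠ ⊤)
    (hY : ∀ j, Y (j + 1) ≤ ENNReal.ofReal (A * b ^ j) * Y j ^ (1 + ν))
    (hsmall : ENNReal.ofReal A * Y 0 ^ ν ≤ ENNReal.ofReal (b ^ (-(1 / ν)))) :
    Tendsto Y atTop (𝓝 0) := by
  set l : ℝ := b ^ (-(1 / ν)) with hl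
  have hb0 : 0 < b := by linarith
  have hl0 : 0 < l := by positivity
  have hl1 : l < 1 := Real.rpow_lt_one_of_one_lt_of_neg hb (by simpa using hν)
  have hlν : b * l ^ ν = 1 := by
    rw [hl, ← Real.rpow_mul hb0.le, neg_mul, one_div, inv_mul_cancel₀ hν.ne', Real.rpow_neg_one,
      mul_inv_cancel₀ hb0.ne']
  have key : ∀ j, Y j ≤ ENNReal.ofReal (l ^ j) * Y 0 := by
    intro j
    induction j with
    | zero => simp
    | succ j ih =>
      have h1 : Y 0 ^ (1 + ν) = Y 0 * Y 0 ^ ν := by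
        rw [ENNReal.rpow_add_of_nonneg _ _ zero_le_one hν.le, ENNReal.rpow_one]
      have h2 : A * b ^ j * (l ^ j) ^ (1 + ν) = A * l ^ j := by
        have h3 : (l ^ j) ^ (1 + ν) = l ^ j * (l ^ ν) ^ j := by
          rw [Real.rpow_add (by positivity), Real.rpow_one, ← Real.rpow_natCast,
            ← Real.rpow_natCast, ← Real.rpow_mul hl0.le, ← Real.rpow_mul hl0.le, mul_comm ν]
        calc A * b ^ j * (l ^ j) ^ (1 + ν) = A * l ^ j * (b * l ^ ν) ^ j := by
              rw [h3, mul_pow]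
              ring
          _ = A * l ^ j := by rw [hlν, one_pow, mul_one]
      calc Y (j + 1) ≤ ENNReal.ofReal (A * b ^ j) * Y j ^ (1 + ν) := hY j
        _ ≤ ENNReal.ofReal (A * b ^ j) * (ENNReal.ofReal (l ^ j) * Y 0) ^ (1 + ν) := by gcongr
        _ = ENNReal.ofReal (A * l ^ j) * (Y 0 * Y 0 ^ ν) := by
            rw [ENNReal.mul_rpow_of_nonneg _ _ (by linarith),
              ENNReal.ofReal_rpow_of_nonneg (by positivity) (by linarith), ← mul_assoc,
              ← ENNReal.ofReal_mul (by positivity), h2, h1]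
        _ = ENNReal.ofReal (l ^ j) * Y 0 * (ENNReal.ofReal A * Y 0 ^ ν) := by
            rw [ENNReal.ofReal_mul hA]
            ring
        _ ≤ ENNReal.ofReal (l ^ j) * Y 0 * ENNReal.ofReal l := by gcongr
        _ = ENNReal.ofReal (l ^ (j + 1)) * Y 0 := by
            rw [pow_succ, ENNReal.ofReal_mul (by positivity)]
            ring
  have h1 : Tendsto (fun j : ℕ => ENNReal.ofReal (l ^ j) * Y 0) atTop (𝓝 0) := by
    have h2 := ENNReal.tendsto_ofReal (tendsto_pow_atTop_nhds_zero_of_lt_one hl0.le hl1)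
    rw [ENNReal.ofReal_zero] at h2
    simpa using ENNReal.Tendsto.mul_const h2 (Or.inr h0)
  exact tendsto_of_tendsto_of_tendsto_of_le_of_le tendsto_const_nhds h1 (fun _ => zero_le) key

/-! ### The De Giorgi iteration -/

theorem quot_neg (s p : ℝ) (u : E n → ℝ) : quot s p (fun x => -u x) = -quot s p u := by
  ext z
  simp only [quot, Pi.neg_apply]
  ring

theorem MemW.neg {s p : ℝ} {U : Set (E n)} {u : E n → ℝ} (hu : MemW s p U u) :
    MemW s p U (fun x => -u x) := by
  refine ⟨hu.1.neg, ?_⟩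
  rw [quot_neg]
  exact hu.2.neg

theorem wNormPow_neg (s p : ℝ) (U : Set (E n)) (u : E n → ℝ) :
    wNormPow s p U (fun x => -u x) = wNormPow s p U u := by
  have h : ∀ a b : ℝ, |-a - -b| = |a - b| := fun a b => by
    rw [← abs_neg]
    congr 1
    ring
  simp only [wNormPow, enorm_neg, h]

theorem MemW0.neg {s p : ℝ} {Ω : Set (E n)} {u : E n → ℝ} (hu : MemW0 s p Ω u) :
    MemW0 s p Ω (fun x => -u x) := by
  refine ⟨hu.1.neg, fun ε hε => ?_⟩
  obtain ⟨g, hg, hgc, hgs, hgε⟩ := hu.2 ε hε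
  refine ⟨-g, hg.neg, hgc.comp_left neg_zero, ?_, ?_⟩
  · rwa [tsupport, Function.support_neg]
  · rw [← wNormPow_neg] at hgε
    convert hgε using 3 with x
    simp only [Pi.neg_apply]
    ring

/-- The assumptions are symmetric in the two solutions, so that a bound from above for `u - v`
yields one from below. -/
theorem SolutionPair.symm {s p : ℝ} [Fact (1 < p)] {Ω Ω' : Set (E n)}
    {f : ℝ → XZeroDual s p Ω Ω'} {u v : ℝ → E n → ℝ} (h : SolutionPair s p Ω Ω' f u v) :
    SolutionPair s p Ω Ω' f v u where
  isOpen := h.isOpen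
  isBounded := h.isBounded
  isOpen' := h.isOpen'
  isBounded' := h.isBounded'
  closure_subset := h.closure_subset
  memDualLoc := h.memDualLoc
  solution_u := h.solution_v
  solution_v := h.solution_u
  memW0 := by
    intro a b ha hab
    obtain ⟨⟨h1, h2, h3⟩, h4⟩ := h.memW0 a b ha hab
    have hneg : (fun t x => v t x - u t x) = fun t x => -(u t x - v t x) := by
      ext t x
      ring
    rw [hneg]
    refine ⟨⟨h1.neg, h2.mono fun t ht => ht.neg, ?_⟩, h4.mono fun t ht => ht.neg⟩
    simpa only [wNormPow_neg] using h3

/-- The ratio of the constants of two consecutive steps of the iteration, when the gaps between the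
levels and between the initial times are halved at each step. -/
def iterRatio (p ν : ℝ) : ℝ := 2 ^ (2 * ν + (p - 1) * (1 + ν))

/-- The constant of the sup bound obtained from a Faber-Krahn inequality with constant `K` and
exponent `ν`. -/
def supConst (K p ν : ℝ) : ℝ :=
  (K * 2 ^ (p - 2) * 4 ^ ν * iterRatio p ν ^ 2 * iterRatio p ν ^ (1 / ν)) ^ (1 / ν)

theorem iterRatio_pos (p ν : ℝ) : 0 < iterRatio p ν := Real.rpow_pos_of_pos two_pos _

theorem supConst_pos {K : ℝ} (hK : 0 < K) (p ν : ℝ) : 0 < supConst K p ν := by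
  have := iterRatio_pos p ν
  unfold supConst
  positivity

/-- The constant of `SolutionPair.excess_step` when the gaps are `k / 2 ^ (j + 2)` in the level and
`T / 2 ^ (j + 2)` in time. -/
theorem step_const_eq {K p ν k T : ℝ} (hk : 0 < k) (hT : 0 < T) (j : ℕ) :
    K * 2 ^ (p - 2) * (4 / (k / 2 ^ (j + 2)) ^ 2) ^ ν *
        (((k / 2 ^ (j + 2)) ^ (p - 2) * (T / 2 ^ (j + 2)))⁻¹) ^ (1 + ν) =
      K * 2 ^ (p - 2) * 4 ^ ν * iterRatio p ν ^ 2 *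
        k ^ (-(2 * ν + (p - 2) * (1 + ν))) * T ^ (-(1 + ν)) * iterRatio p ν ^ j := by
  set r : ℝ := 2 ^ (j + 2) with hr
  have hr0 : 0 < r := by positivity
  have h1 : (4 / (k / r) ^ 2) ^ ν = 4 ^ ν * (k / r) ^ (-(2 * ν)) := by
    rw [Real.div_rpow (by norm_num) (by positivity), ← Real.rpow_natCast (k / r),
      ← Real.rpow_mul (by positivity), Real.rpow_neg (by positivity), div_eq_mul_inv]
    norm_num
  have h2 : (((k / r) ^ (p - 2) * (T / r))⁻¹) ^ (1 + ν) =
      (k / r) ^ (-((p - 2) * (1 + ν))) * (T / r) ^ (-(1 + ν)) := by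
    rw [Real.inv_rpow (by positivity), Real.mul_rpow (by positivity) (by positivity),
      ← Real.rpow_mul (by positivity), mul_inv, Real.rpow_neg (by positivity),
      Real.rpow_neg (by positivity)]
  have h3 : (k / r) ^ (-(2 * ν)) * (k / r) ^ (-((p - 2) * (1 + ν))) =
      k ^ (-(2 * ν + (p - 2) * (1 + ν))) * r ^ (2 * ν + (p - 2) * (1 + ν)) := by
    rw [← Real.rpow_add (by positivity), ← neg_add, Real.div_rpow hk.le hr0.le,
      Real.rpow_neg hr0.le, div_inv_eq_mul]
  have h4 : (T / r) ^ (-(1 + ν)) = T ^ (-(1 + ν)) * r ^ (1 + ν) := by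
    rw [Real.div_rpow hT.le hr0.le, Real.rpow_neg hr0.le, div_inv_eq_mul]
  have h5 : r ^ (2 * ν + (p - 2) * (1 + ν)) * r ^ (1 + ν) =
      iterRatio p ν ^ 2 * iterRatio p ν ^ j := by
    rw [← Real.rpow_add hr0, ← pow_add, iterRatio, hr, ← Real.rpow_natCast, ← Real.rpow_natCast,
      ← Real.rpow_mul two_pos.le, ← Real.rpow_mul two_pos.le]
    congr 1
    push_cast
    ring
  calc _ = K * 2 ^ (p - 2) * 4 ^ ν * ((k / r) ^ (-(2 * ν)) * (k / r) ^ (-((p - 2) * (1 + ν)))) *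
        (T / r) ^ (-(1 + ν)) := by
        rw [h1, h2]
        ring
    _ = K * 2 ^ (p - 2) * 4 ^ ν * k ^ (-(2 * ν + (p - 2) * (1 + ν))) * T ^ (-(1 + ν)) *
        (r ^ (2 * ν + (p - 2) * (1 + ν)) * r ^ (1 + ν)) := by
        rw [h3, h4]
        ring
    _ = _ := by
        rw [h5]
        ring

section

variable {s p : ℝ} [Fact (1 < p)] {Ω Ω' : Set (E n)} {f : ℝ → XZeroDual s p Ω Ω'}
  {u v : ℝ → E n → ℝ}

/-- De Giorgi iteration between the levels `0` and `k` and the initial times `T / 2` and `T`. -/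
theorem SolutionPair.ae_le_of_level (h : SolutionPair s p Ω Ω' f u v) (hs : 0 < s) (hp : 2 < p)
    {K ν : ℝ} (hK : 0 < K) (hν : 0 < ν)
    (hFK : ∀ g : E n → ℝ, AEMeasurable g → (∀ᵐ x, x ∉ Ω → g x = 0) →
      ∫⁻ x, ‖g x‖ₑ ^ p ≤
        ENNReal.ofReal K * volume {x | g x ≠ 0} ^ ν * ∫⁻ z, ‖quot s p g z‖ₑ ^ p)
    {T t₂ k : ℝ} (hT : 0 < T) (hTt : T ≤ t₂) (hk : 0 < k)
    (hI : ∫⁻ t in Icc (T / 2) t₂, ∫⁻ x in Ω, ‖u t x - v t x‖ₑ ^ p ≠ ⊤)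
    (hlevel : ENNReal.ofReal (supConst K p ν * T ^ (-((1 + ν) / ν))) *
        ∫⁻ t in Icc (T / 2) t₂, ∫⁻ x in Ω, ‖u t x - v t x‖ₑ ^ p ≤
      ENNReal.ofReal (k ^ (p + (p - 2) / ν))) :
    ∀ᵐ q ∂(cylMeasure T t₂ Ω), u q.1 q.2 - v q.1 q.2 ≤ k := by
  set w : ℝ → E n → ℝ := fun t x => u t x - v t x with hw
  set I := ∫⁻ t in Icc (T / 2) t₂, ∫⁻ x in Ω, ‖u t x - v t x‖ₑ ^ p with hIdef
  set b := iterRatio p ν with hb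
  have hb0 : 0 < b := iterRatio_pos p ν
  have hb1 : 1 < b := by
    refine Real.one_lt_rpow one_lt_two ?_
    have : 0 < p - 1 := by linarith
    positivity
  set G : ℝ := K * 2 ^ (p - 2) * 4 ^ ν * b ^ 2 with hG
  have hG0 : 0 < G := by positivity
  set A : ℝ := G * k ^ (-(2 * ν + (p - 2) * (1 + ν))) * T ^ (-(1 + ν)) with hA
  have hA0 : 0 < A := by positivity
  have hp0 : 0 < p := by linarith
  -- initial times increasing from `T / 2` to `T`, and levels increasing from `0` to `k`
  set tt : ℕ → ℝ := fun j => T - T / 2 ^ (j + 1) with htt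
  set kk : ℕ → ℝ := fun j => k - k / 2 ^ j with hkk
  have hpow : ∀ j : ℕ, (1 : ℝ) ≤ 2 ^ j := fun j => one_le_pow₀ one_le_two
  have htT : ∀ j, tt j ≤ T := fun j => sub_le_self _ (by positivity)
  have hkk' : ∀ j, kk j ≤ k := fun j => sub_le_self _ (by positivity)
  have hkk0 : ∀ j, 0 ≤ kk j := fun j => sub_nonneg.2 (div_le_self hk.le (hpow j))
  have htt0 : ∀ j, 0 < tt j := fun j => sub_pos.2 (div_lt_self hT
    (one_lt_pow₀ one_lt_two (Nat.succ_ne_zero j)))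
  have hmeas : AEMeasurable (fun q : ℝ × E n => w q.1 q.2) (cylMeasure (T / 2) t₂ Ω) :=
    h.aemeasurable (by positivity) (by linarith)
  set Y : ℕ → ℝ≥0∞ := fun j => excess p Ω w (tt j) t₂ (kk j) with hY
  have hY0 : Y 0 ≤ I := by
    have h0 : tt 0 = T / 2 := by
      simp only [htt, zero_add, pow_one]
      ring
    have h1 : kk 0 = 0 := by simp [hkk]
    have h2 : I = ∫⁻ q, ‖w q.1 q.2‖ₑ ^ p ∂(cylMeasure (T / 2) t₂ Ω) :=
      (lintegral_prod _ (hmeas.enorm.pow_const p)).symm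
    rw [h2]
    simp only [hY, h0, h1, excess]
    gcongr with q
    rw [Real.enorm_eq_ofReal_abs, sub_zero]
    exact ENNReal.ofReal_le_ofReal (max_le (abs_nonneg _) (le_abs_self _))
  have hstep : ∀ j, Y (j + 1) ≤ ENNReal.ofReal (A * b ^ j) * Y j ^ (1 + ν) := by
    intro j
    have hd : tt (j + 1) - tt j = T / 2 ^ (j + 2) := by
      simp only [htt]
      field_simp
      ring
    have hl : kk j + 2 * (k / 2 ^ (j + 2)) = kk (j + 1) := by
      simp only [hkk]
      field_simp
      ring
    have hlt : tt j < tt (j + 1) := by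
      rw [← sub_pos, hd]
      positivity
    have h1 := h.excess_step hs hp hK hν hFK (hkk0 j) (by positivity : 0 < k / 2 ^ (j + 2))
      (htt0 j) hlt ((htT _).trans hTt)
    rw [hd, hl, step_const_eq hk hT] at h1
    exact h1
  have hsmall : ENNReal.ofReal A * Y 0 ^ ν ≤ ENNReal.ofReal (b ^ (-(1 / ν))) := by
    have h1 : ENNReal.ofReal (G * b ^ (1 / ν) * T ^ (-(1 + ν))) * I ^ ν ≤
        ENNReal.ofReal (k ^ (2 * ν + (p - 2) * (1 + ν))) := by
      have h2 := ENNReal.rpow_le_rpow hlevel hν.le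
      rw [ENNReal.mul_rpow_of_nonneg _ _ hν.le,
        ENNReal.ofReal_rpow_of_nonneg (by have := supConst_pos hK p ν; positivity) hν.le,
        ENNReal.ofReal_rpow_of_nonneg (by positivity) hν.le, ← Real.rpow_mul hk.le,
        Real.mul_rpow (supConst_pos hK p ν).le (by positivity), ← Real.rpow_mul hT.le, supConst,
        ← Real.rpow_mul (by positivity), one_div_mul_cancel hν.ne', Real.rpow_one] at h2
      convert h2 using 4
      · field_simp
      · field_simp
        ring
    have h3 : A = b ^ (-(1 / ν)) * k ^ (-(2 * ν + (p - 2) * (1 + ν))) *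
        (G * b ^ (1 / ν) * T ^ (-(1 + ν))) := by
      have h4 : b ^ (-(1 / ν)) * b ^ (1 / ν) = 1 := by
        rw [← Real.rpow_add hb0, neg_add_cancel, Real.rpow_zero]
      calc A = (b ^ (-(1 / ν)) * b ^ (1 / ν)) * A := by rw [h4, one_mul]
        _ = _ := by
          rw [hA]
          ring
    have h5 : k ^ (-(2 * ν + (p - 2) * (1 + ν))) * k ^ (2 * ν + (p - 2) * (1 + ν)) = 1 := by
      rw [← Real.rpow_add hk, neg_add_cancel, Real.rpow_zero]
    calc ENNReal.ofReal A * Y 0 ^ ν ≤ ENNReal.ofReal A * I ^ ν := by gcongr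
      _ = ENNReal.ofReal (b ^ (-(1 / ν)) * k ^ (-(2 * ν + (p - 2) * (1 + ν)))) *
          (ENNReal.ofReal (G * b ^ (1 / ν) * T ^ (-(1 + ν))) * I ^ ν) := by
          rw [h3, ENNReal.ofReal_mul (by positivity), mul_assoc]
      _ ≤ ENNReal.ofReal (b ^ (-(1 / ν)) * k ^ (-(2 * ν + (p - 2) * (1 + ν)))) *
          ENNReal.ofReal (k ^ (2 * ν + (p - 2) * (1 + ν))) := by gcongr
      _ = ENNReal.ofReal (b ^ (-(1 / ν))) := by
          rw [← ENNReal.ofReal_mul (by positivity), mul_assoc, h5, mul_one]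
  have hlim := tendsto_zero_of_superlinear hA0.le hb1 hν (ne_top_of_le_ne_top hI hY0) hstep hsmall
  have hzero : excess p Ω w T t₂ k = 0 :=
    le_antisymm (ge_of_tendsto' hlim fun j => excess_mono hp0.le Ω w (htT j) (hkk' j)) zero_le
  have hmeas' : AEMeasurable (fun q : ℝ × E n => w q.1 q.2) (cylMeasure T t₂ Ω) :=
    hmeas.mono_measure (Measure.prod_mono
      (Measure.restrict_mono (Icc_subset_Icc_left (by linarith)) le_rfl) le_rfl)
  rw [excess, lintegral_eq_zero_iff'
    ((aemeasurable_const.max (hmeas'.sub_const k)).ennreal_ofReal.pow_const p)] at hzero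
  filter_upwards [hzero] with q hq
  have h1 : ENNReal.ofReal (max 0 (w q.1 q.2 - k)) = 0 := by
    simpa [ENNReal.rpow_eq_zero_iff, hp0, hp0.not_gt] using hq
  have h2 := ENNReal.ofReal_eq_zero.1 h1
  linarith [le_max_right 0 (w q.1 q.2 - k)]

/-- A Faber-Krahn inequality on `Ω` with exponent `ν = s * p / d` yields the sup bound with the
effective dimension `d`. -/
theorem SolutionPair.moserBound (h : SolutionPair s p Ω Ω' f u v) (hs : 0 < s) (hp : 2 < p)
    {K d : ℝ} (hK : 0 < K) (hd : 0 < d)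
    (hFK : ∀ g : E n → ℝ, AEMeasurable g → (∀ᵐ x, x ∉ Ω → g x = 0) →
      ∫⁻ x, ‖g x‖ₑ ^ p ≤
        ENNReal.ofReal K * volume {x | g x ≠ 0} ^ (s * p / d) * ∫⁻ z, ‖quot s p g z‖ₑ ^ p)
    {T t₂ : ℝ} (hT : 0 < T) (hTt : T ≤ t₂) :
    MoserBound s p d (supConst K p (s * p / d)) Ω (fun t x => u t x - v t x) T t₂ := by
  have hp0 : 0 < p := by linarith
  set ν : ℝ := s * p / d with hν
  have hν0 : 0 < ν := by positivity
  have he : d * (p - 2) / (s * p) + p = p + (p - 2) / ν := by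
    rw [hν]
    field_simp
    ring
  have he0 : 0 < p + (p - 2) / ν := by
    have : 0 < p - 2 := by linarith
    positivity
  have hT' : -((d + s * p) / (s * p)) = -((1 + ν) / ν) := by
    rw [hν]
    field_simp
  rw [MoserBound, he, hT']
  set I := ∫⁻ t in Icc (T / 2) t₂, ∫⁻ x in Ω, ‖u t x - v t x‖ₑ ^ p with hIdef
  have hI : I ≠ ⊤ := by
    refine ne_top_of_le_ne_top (h.memW0 (T / 2) t₂ (by positivity) (by linarith)).1.2.2.ne ?_
    refine lintegral_mono fun t => le_trans ?_ le_self_add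
    exact lintegral_mono_set (subset_univ _)
  set R : ℝ≥0∞ := ENNReal.ofReal (supConst K p ν * T ^ (-((1 + ν) / ν))) * I with hR
  have hRtop : R ≠ ⊤ := ENNReal.mul_ne_top ENNReal.ofReal_ne_top hI
  refine ENNReal.le_of_forall_pos_le_add fun ε hε _ => ?_
  -- the level at which the smallness condition of the iteration holds with room `ε`
  set k : ℝ := (R.toReal + ε) ^ (p + (p - 2) / ν)⁻¹ with hk
  have hRε : 0 < R.toReal + ε := by positivity
  have hk0 : 0 < k := Real.rpow_pos_of_pos hRε _
  have hke : ENNReal.ofReal (k ^ (p + (p - 2) / ν)) = R + ε := by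
    rw [hk, ← Real.rpow_mul hRε.le, inv_mul_cancel₀ he0.ne', Real.rpow_one,
      ENNReal.ofReal_add (by positivity) (by positivity), ENNReal.ofReal_toReal hRtop,
      ENNReal.ofReal_coe_nnreal]
  have hsymm : ∫⁻ t in Icc (T / 2) t₂, ∫⁻ x in Ω, ‖v t x - u t x‖ₑ ^ p = I := by
    rw [hIdef]
    refine lintegral_congr fun t => lintegral_congr fun x => ?_
    rw [← enorm_neg, neg_sub]
  have h1 := h.ae_le_of_level hs hp hK hν0 hFK hT hTt hk0 hI (hke ▸ le_self_add)
  have h2 := h.symm.ae_le_of_level hs hp hK hν0 hFK hT hTt hk0 (hsymm ▸ hI)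
    (by rw [hsymm, hke]; exact le_self_add)
  rw [← hke, ← ENNReal.ofReal_rpow_of_nonneg hk0.le he0.le]
  refine ENNReal.rpow_le_rpow ?_ he0.le
  rw [eLpNorm_exponent_top, Measure.volume_eq_prod, ← Measure.prod_restrict]
  refine eLpNormEssSup_le_of_ae_bound ?_
  filter_upwards [h1, h2] with q hq1 hq2
  rw [Real.norm_eq_abs]
  exact abs_le.2 ⟨by linarith, hq1⟩

end

/-- On a set of finite measure, the exponent in the Faber-Krahn inequality can be lowered at the
price of a constant that depends on the set. -/
theorem rpow_le_mul_rpow_of_le {a m : ℝ≥0∞} (ham : a ≤ m) {α β : ℝ} (hβ : 0 < β) (hαβ : β ≤ α) :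
    a ^ α ≤ m ^ (α - β) * a ^ β := by
  have h := ENNReal.rpow_add_of_nonneg (x := a) (α - β) β (sub_nonneg.2 hαβ) hβ.le
  rw [sub_add_cancel] at h
  rw [h]
  gcongr

end FracPLap

end

theorem mainTheorem5 (n : ℕ) (hn : 1 ≤ n) (s p : ℝ) (hs0 : 0 < s) (hs1 : s < 1)
    [Fact (1 < p)] (hp : 2 < p) :
    (s * p < n →
      ∃ C : ℝ, 0 < C ∧
        ∀ (Ω Ω' : Set (FracPLap.E n)) (f : ℝ → FracPLap.XZeroDual s p Ω Ω')
          (u v : ℝ → FracPLap.E n → ℝ), FracPLap.SolutionPair s p Ω Ω' f u v →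
          ∀ T t₂ : ℝ, 0 < T → T ≤ t₂ →
            FracPLap.MoserBound s p n C Ω (fun t x => u t x - v t x) T t₂) ∧
    (∀ N : ℝ, n ≤ s * p → s * p < N →
      ∀ Ω : Set (FracPLap.E n), ∃ C : ℝ, 0 < C ∧
        ∀ (Ω' : Set (FracPLap.E n)) (f : ℝ → FracPLap.XZeroDual s p Ω Ω')
          (u v : ℝ → FracPLap.E n → ℝ), FracPLap.SolutionPair s p Ω Ω' f u v →
          ∀ T t₂ : ℝ, 0 < T → T ≤ t₂ →
            FracPLap.MoserBound s p N C Ω (fun t x => u t x - v t x) T t₂) := by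
  have hp1 : 1 < p := by linarith
  have hn0 : (0 : ℝ) < n := by exact_mod_cast hn
  obtain ⟨K, hK, hFK⟩ := FracPLap.exists_faberKrahn hn hs0 hp1
  have hsub : ∀ {Ω : Set (FracPLap.E n)} {g : FracPLap.E n → ℝ}, (∀ᵐ x, x ∉ Ω → g x = 0) →
      volume {x | g x ≠ 0} ≤ volume Ω := by
    intro Ω g hg
    refine measure_mono_ae ?_
    filter_upwards [hg] with x hx hgx
    by_contra hxΩ
    exact hgx (hx hxΩ)
  refine ⟨fun _ => ⟨_, FracPLap.supConst_pos hK p (s * p / n), ?_⟩, ?_⟩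
  · intro Ω Ω' f u v h T t₂ hT hTt
    refine h.moserBound hs0 hp hK hn0 (fun g hg hgΩ => hFK g hg ?_) hT hTt
    exact ne_top_of_le_ne_top h.isBounded.measure_lt_top.ne (hsub hgΩ)
  · intro N hnN hN Ω
    have hN0 : 0 < N := by linarith
    set m : ℝ≥0∞ := volume Ω ^ (s * p / n - s * p / N) with hm
    have hle : s * p / N ≤ s * p / n := by
      have : 0 < s * p := by positivity
      gcongr
      linarith
    -- the summand `1` keeps the constant positive when `Ω` is a null set
    have hK' : 0 < K * (m.toReal + 1) := by positivity
    refine ⟨_, FracPLap.supConst_pos hK' p (s * p / N), ?_⟩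
    intro Ω' f u v h T t₂ hT hTt
    have hΩ : volume Ω ≠ ⊤ := h.isBounded.measure_lt_top.ne
    have hmK : ENNReal.ofReal K * m ≤ ENNReal.ofReal (K * (m.toReal + 1)) := by
      have hmtop : m ≠ ⊤ := ENNReal.rpow_ne_top_of_nonneg (sub_nonneg.2 hle) hΩ
      rw [ENNReal.ofReal_mul hK.le]
      gcongr
      rw [← ENNReal.ofReal_toReal hmtop]
      exact ENNReal.ofReal_le_ofReal (by simp)
    refine h.moserBound hs0 hp hK' hN0 (fun g hg hgΩ => ?_) hT hTt
    refine (hFK g hg (ne_top_of_le_ne_top hΩ (hsub hgΩ))).trans ?_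
    refine mul_le_mul' ?_ le_rfl
    calc ENNReal.ofReal K * volume {x | g x ≠ 0} ^ (s * p / n)
        ≤ ENNReal.ofReal K * (m * volume {x | g x ≠ 0} ^ (s * p / N)) := by
          gcongr
          exact FracPLap.rpow_le_mul_rpow_of_le (hsub hgΩ) (by positivity) hle
      _ ≤ _ := by
          rw [← mul_assoc]
          gcongr
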